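/- Let $n\ge 1$, write points of $\mathbb R^{n+1}=\mathbb R^n\times\mathbb R$ as $X=(x,x_{n+1})$, and let $\Omega\subset\mathbb R^{n+1}$ be a domain (nonempty, open, connected) that is symmetric with respect to $\{x_{n+1}=0\}$. For an open set $D$ let $$E(u,D)=\int_D|\nabla u|^2\,dX+\mathcal H^n(\{(x,0)\in D:\ u(x,0)>0\}),$$ where $u(x,0)$ is understood in the sense of traces. A function $u$ is called a minimizer of $E$ in $\Omega$ if $u\in H^1_{loc}(\Omega)$, $u\ge 0$, $u$ is even in $x_{n+1}$, and $E(u,D)\le E(v,D)$ for every domain $D\subset\subset\Omega$ and every $v\in H^1_{loc}(\Omega)$ that coincides with $u$ in a neighborhood of $\Omega\setminus D$; such a $u$ is always given pointwise by $u(X)=\lim_{r\to0^+}\frac{1}{|B_r(X)|}\int_{B_r(X)}u\,dY$ for $X\in\Omega$. For subsets of an open set $W$ of a Euclidean space, $A_k\to A$ locally in the Hausdorff distance in $W$ means that for every compact $K\subset W$ and every $\varepsilon>0$, for all large $k$, $A_k\cap K$ is contained in the $\varepsilon$-neighborhood of $A$ and $A\cap K$ is contained in the $\varepsilon$-neighborhood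 of $A_k$. **Theorem (compactness of minimizers).** Let $u_k$ be minimizers of $E$ in $\Omega$ with $u_k\to u$ locally uniformly in $\Omega$. Then $u$ is a minimizer of $E$ in $\Omega$. Moreover, the zero sets on the hyperplane converge: $$\{x:\ (x,0)\in\Omega,\ u_k(x,0)=0\}\to\{x:\ (x,0)\in\Omega,\ u(x,0)=0\}$$ locally in the Hausdorff distance in $\{x\in\mathbb R^n:(x,0)\in\Omega\}$. If $u\not\equiv0$ in $\Omega$, then also the full zero sets $\{X\in\Omega:u_k(X)=0\}$ converge to $\{X\in\Omega:u(X)=0\}$ locally in the Hausdorff distance in $\Omega$. -/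

import Mathlib

open MeasureTheory Filter Topology
open scoped ContDiff ENNReal

noncomputable section

namespace ThinOnePhase

/-- The embedding `x ↦ (x, 0)` of `ℝⁿ` into `ℝⁿ⁺¹ = ℝⁿ × ℝ`; the last coordinate is `x_{n+1}`. -/
def thin {n : ℕ} (x : EuclideanSpace ℝ (Fin n)) : EuclideanSpace ℝ (Fin (n + 1)) :=
  WithLp.toLp 2 (Fin.snoc (α := fun _ => ℝ) (fun i => x i) 0)

/-- The reflection `(x, x_{n+1}) ↦ (x, -x_{n+1})`. -/
def reflectLast {n : ℕ} (X : EuclideanSpace ℝ (Fin (n + 1))) : EuclideanSpace ℝ (Fin (n + 1)) :=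
  WithLp.toLp 2 (Function.update (fun i => X i) (Fin.last n) (-X (Fin.last n)))

/-- `G` is the weak (distributional) gradient of `u` in the open set `Ω`. -/
def HasWeakGradient {N : ℕ} (Ω : Set (EuclideanSpace ℝ (Fin N)))
    (u : EuclideanSpace ℝ (Fin N) → ℝ)
    (G : EuclideanSpace ℝ (Fin N) → EuclideanSpace ℝ (Fin N)) : Prop :=
  LocallyIntegrableOn u Ω volume ∧ LocallyIntegrableOn G Ω volume ∧
    ∀ φ : EuclideanSpace ℝ (Fin N) → ℝ,
      ContDiff ℝ ∞ φ → HasCompactSupport φ → tsupport φ ⊆ Ω →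
        ∀ e : EuclideanSpace ℝ (Fin N),
          ∫ X in Ω, u X * fderiv ℝ φ X e = -∫ X in Ω, φ X * inner ℝ (G X) e

/-- `u ∈ H¹_loc(Ω)`: `u` has a weak gradient in `Ω`, and `u` and its weak gradient are square
integrable on every compact subset of `Ω`. -/
def MemH1loc {N : ℕ} (Ω : Set (EuclideanSpace ℝ (Fin N)))
    (u : EuclideanSpace ℝ (Fin N) → ℝ) : Prop :=
  ∃ G : EuclideanSpace ℝ (Fin N) → EuclideanSpace ℝ (Fin N), HasWeakGradient Ω u G ∧
    ∀ K : Set (EuclideanSpace ℝ (Fin N)), IsCompact K → K ⊆ Ω →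
      MemLp u 2 (volume.restrict K) ∧ MemLp G 2 (volume.restrict K)

open Classical in
/-- The weak gradient `∇u` of `u` in `Ω`. It is unique up to null sets when it exists; the value
is `0` when there is none. -/
def weakGrad {N : ℕ} (Ω : Set (EuclideanSpace ℝ (Fin N)))
    (u : EuclideanSpace ℝ (Fin N) → ℝ) :
    EuclideanSpace ℝ (Fin N) → EuclideanSpace ℝ (Fin N) :=
  if h : ∃ G, HasWeakGradient Ω u G then Classical.choose h else 0

/-- `a` is the precise value of `u` at `X`: the limit of the averages of `u` over the balls
`B_r(X)` as `r → 0⁺`. -/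
def HasPreciseValue {N : ℕ} (u : EuclideanSpace ℝ (Fin N) → ℝ)
    (X : EuclideanSpace ℝ (Fin N)) (a : ℝ) : Prop :=
  Tendsto (fun r : ℝ => ⨍ Y in Metric.ball X r, u Y) (𝓝[>] 0) (𝓝 a)

/-- The set `{x ∈ ℝⁿ : (x, 0) ∈ D, u(x, 0) > 0}`. The value `u(x, 0)` is the precise value: a
function in `H¹_loc` has one at `ℋⁿ`-almost every point of the hyperplane, and it is the value of
the trace of the function. -/
def thinPositive {n : ℕ} (u : EuclideanSpace ℝ (Fin (n + 1)) → ℝ)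
    (D : Set (EuclideanSpace ℝ (Fin (n + 1)))) : Set (EuclideanSpace ℝ (Fin n)) :=
  {x | thin x ∈ D ∧ ∃ a : ℝ, 0 < a ∧ HasPreciseValue u (thin x) a}

/-- The energy `E(u, D) = ∫_D |∇u|² dX + ℋⁿ({(x, 0) ∈ D : u(x, 0) > 0})`. On `ℝⁿ × {0}` the
measure `ℋⁿ` is the Lebesgue measure of `ℝⁿ`. -/
def energy {n : ℕ} (u : EuclideanSpace ℝ (Fin (n + 1)) → ℝ)
    (D : Set (EuclideanSpace ℝ (Fin (n + 1)))) : ℝ≥0∞ :=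
  (∫⁻ X in D, ‖weakGrad D u X‖ₑ ^ 2) + volume (thinPositive u D)

/-- `u` is a local minimizer of `E` in `Ω`: `u ∈ H¹_loc(Ω)` and `E(u, D) ≤ E(v, D)` for every
domain `D ⊂⊂ Ω` and every `v ∈ H¹_loc(Ω)` that coincides with `u` (almost everywhere) in a
neighborhood of `Ω \ D`. -/
def IsLocalMinimizer {n : ℕ} (Ω : Set (EuclideanSpace ℝ (Fin (n + 1))))
    (u : EuclideanSpace ℝ (Fin (n + 1)) → ℝ) : Prop :=
  MemH1loc Ω u ∧
    ∀ D : Set (EuclideanSpace ℝ (Fin (n + 1))),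
      IsOpen D → IsConnected D → IsCompact (closure D) → closure D ⊆ Ω →
      ∀ v : EuclideanSpace ℝ (Fin (n + 1)) → ℝ, MemH1loc Ω v →
        (∃ U : Set (EuclideanSpace ℝ (Fin (n + 1))), IsOpen U ∧ Ω \ D ⊆ U ∧
          ∀ᵐ X ∂volume, X ∈ Ω ∩ U → v X = u X) →
        energy u D ≤ energy v D

/-- Minimizers of `E` in `Ω`: local minimizers that are nonnegative, even in `x_{n+1}`, and given
at every point of `Ω` by their precise value. -/
structure IsMinimizer {n : ℕ} (Ω : Set (EuclideanSpace ℝ (Fin (n + 1))))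
    (u : EuclideanSpace ℝ (Fin (n + 1)) → ℝ) : Prop where
  nonneg : ∀ X ∈ Ω, 0 ≤ u X
  even : ∀ X ∈ Ω, u (reflectLast X) = u X
  precise : ∀ X ∈ Ω, HasPreciseValue u X (u X)
  minimizes : IsLocalMinimizer Ω u

/-- The zero set of `u` on the hyperplane, `{x ∈ ℝⁿ : (x, 0) ∈ Ω, u(x, 0) = 0}`. -/
def thinZero {n : ℕ} (Ω : Set (EuclideanSpace ℝ (Fin (n + 1))))
    (u : EuclideanSpace ℝ (Fin (n + 1)) → ℝ) : Set (EuclideanSpace ℝ (Fin n)) :=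
  {x | thin x ∈ Ω ∧ u (thin x) = 0}

/-- The sets `A k ⊆ W` converge to `B ⊆ W` locally in the Hausdorff distance in `W`: for every
compact `K ⊆ W` and `ε > 0`, if `k` is large, every point of `A k ∩ K` has distance less than `ε`
from a point of `B`, and every point of `B ∩ K` has distance less than `ε` from a point of `A k`. -/
def LocallyHausdorffTendsto {α : Type*} [PseudoMetricSpace α] (W : Set α)
    (A : ℕ → Set α) (B : Set α) : Prop :=
  ∀ K : Set α, IsCompact K → K ⊆ W → ∀ ε : ℝ, 0 < ε → ∀ᶠ k in atTop,
    A k ∩ K ⊆ Metric.thickening ε B ∧ B ∩ K ⊆ Metric.thickening ε (A k)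

end ThinOnePhase

end

/-! The only compactness needed beyond uniform convergence is strong $L^2_{loc}$ convergence of
gradients, and it comes from one-sided variations. Subtracting a nonnegative function from a
minimizer cannot enlarge its positivity set, so minimizers are weakly subharmonic
(`IsMinimizer.integral_inner_nonpos`), which gives a Caccioppoli inequality. If $w=u_2-u_1$ and
$|w|\le\delta$, then $\eta(\delta-w)$ and $\eta(\delta+w)$ are both nonnegative; testing $u_1$ with
the first and $u_2$ with the second and adding yields $\int\eta|\nabla w|^2\le C\delta$
(`exists_cauchy_estimate`). Hence the gradients are locally Cauchy, and their limit is $\nabla u$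
(`exists_gradient_limit`).

Minimality passes to the limit by gluing. For a competitor $v$ of $u$ take $\varphi
v+(1-\varphi)u_k$ as competitor of $u_k$, with $\varphi=1$ near the set where $v$ and $u$ may
differ. The Dirichlet terms converge. In the area term the part of $\{u_k>0\}$ away from that set
occurs on both sides and cancels, so only $|\{u>0\}\setminus\{u_k>0\}|\to0$ is needed, and this
follows from pointwise convergence (`isLocalMinimizer_of_tendsto`).

For the zero sets, a minimizer positive on the hyperplane part of a ball is weakly harmonic there,
so at precise values it has the mean value property (`HasPreciseValue.setIntegral_ball`); continuity
of minimizers is never used. If $u>0$ on such a part, the mean value property bounds $u$ below on a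
smaller ball, and uniform convergence excludes zeros of $u_k$ there. Conversely, suppose $u(y,0)=0$
while infinitely many $u_k$ are positive on the hyperplane near $y$. A Harnack estimate then forces
$u=0$ in a ball, so $u_k$ and $\nabla u_k$ tend to $0$ in $L^2$ there. Cutting such a $u_k$ off
saves a fixed amount of area at vanishing Dirichlet cost, contradicting minimality
(`eventually_exists_zero`).

Finally, minimizers are harmonic off the hyperplane. The strong maximum principle and evenness show
that a zero off the hyperplane forces $w\equiv0$ (`IsMinimizer.eq_zero_of_off_thin`). If
$u\not\equiv0$, then for large $k$ all zeros therefore lie on the hyperplane, and the full statement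
reduces to the thin one. -/

noncomputable section

namespace ThinOnePhase

/-! ### Weak gradients and the calculus of $H^1_{loc}$ -/

variable {N : ℕ}

/-- `u ∈ H¹_loc(Ω)` with weak gradient `G`. -/
def IsH1 (Ω : Set (EuclideanSpace ℝ (Fin N))) (u : EuclideanSpace ℝ (Fin N) → ℝ)
    (G : EuclideanSpace ℝ (Fin N) → EuclideanSpace ℝ (Fin N)) : Prop :=
  HasWeakGradient Ω u G ∧
    ∀ K : Set (EuclideanSpace ℝ (Fin N)), IsCompact K → K ⊆ Ω →
      MemLp u 2 (volume.restrict K) ∧ MemLp G 2 (volume.restrict K)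

/-- Smooth functions with compact support in `Ω`. -/
def IsTest (Ω : Set (EuclideanSpace ℝ (Fin N))) (φ : EuclideanSpace ℝ (Fin N) → ℝ) : Prop :=
  ContDiff ℝ ∞ φ ∧ HasCompactSupport φ ∧ tsupport φ ⊆ Ω

variable {Ω D K : Set (EuclideanSpace ℝ (Fin N))} {u v φ : EuclideanSpace ℝ (Fin N) → ℝ}
  {G F : EuclideanSpace ℝ (Fin N) → EuclideanSpace ℝ (Fin N)}

lemma IsTest.mono (h : IsTest D φ) (hD : D ⊆ Ω) : IsTest Ω φ :=
  ⟨h.1, h.2.1, h.2.2.trans hD⟩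

lemma IsTest.continuous (h : IsTest D φ) : Continuous φ := h.1.continuous

lemma continuous_gradient (h : ContDiff ℝ ∞ φ) : Continuous (gradient φ) :=
  (LinearIsometryEquiv.continuous _).comp (h.continuous_fderiv (by simp))

lemma fderiv_eq_inner_gradient (X e : EuclideanSpace ℝ (Fin N)) :
    fderiv ℝ φ X e = inner ℝ (gradient φ X) e := (inner_gradient_left).symm

lemma fderiv_zero_of_notMem_tsupport {X : EuclideanSpace ℝ (Fin N)} (h : X ∉ tsupport φ) :
    fderiv ℝ φ X = 0 := by
  by_contra h'
  exact h (support_fderiv_subset ℝ h')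

lemma gradient_zero_of_notMem_tsupport {X : EuclideanSpace ℝ (Fin N)} (h : X ∉ tsupport φ) :
    gradient φ X = 0 := by
  rw [gradient, fderiv_zero_of_notMem_tsupport h, map_zero]

lemma memLp_smul_of_continuous {E : Type*} [NormedAddCommGroup E] [NormedSpace ℝ E]
    {f : EuclideanSpace ℝ (Fin N) → E} {g : EuclideanSpace ℝ (Fin N) → ℝ} {p : ℝ≥0∞}
    (hK : IsCompact K) (hg : Continuous g) (hf : MemLp f p (volume.restrict K)) :
    MemLp (fun X => g X • f X) p (volume.restrict K) := by
  obtain ⟨C, hC⟩ := hK.exists_bound_of_continuousOn hg.continuousOn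
  refine hf.of_le_mul (c := C) (hg.aestronglyMeasurable.smul hf.1) ?_
  filter_upwards [ae_restrict_mem hK.measurableSet] with X hX
  rw [norm_smul]
  gcongr
  exact hC X hX

lemma memLp_smul_of_continuous' {E : Type*} [NormedAddCommGroup E] [NormedSpace ℝ E]
    {f : EuclideanSpace ℝ (Fin N) → ℝ} {g : EuclideanSpace ℝ (Fin N) → E} {p : ℝ≥0∞}
    (hK : IsCompact K) (hg : Continuous g) (hf : MemLp f p (volume.restrict K)) :
    MemLp (fun X => f X • g X) p (volume.restrict K) := by
  obtain ⟨C, hC⟩ := hK.exists_bound_of_continuousOn hg.continuousOn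
  refine hf.of_le_mul (c := C) (hf.1.smul hg.aestronglyMeasurable) ?_
  filter_upwards [ae_restrict_mem hK.measurableSet] with X hX
  rw [norm_smul, mul_comm]
  gcongr
  exact hC X hX

lemma integrable_smul_of_tsupport_subset {E : Type*} [NormedAddCommGroup E] [NormedSpace ℝ E]
    {f : EuclideanSpace ℝ (Fin N) → E} {g : EuclideanSpace ℝ (Fin N) → ℝ}
    (hf : LocallyIntegrableOn f Ω volume) (hg : Continuous g) (hK : IsCompact K) (hKΩ : K ⊆ Ω)
    (h0 : ∀ X ∉ K, g X = 0) : Integrable (fun X => g X • f X) volume := by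
  have h1 : IntegrableOn f K volume := hf.integrableOn_compact_subset hKΩ hK
  have h2 : IntegrableOn (fun X => g X • f X) K volume :=
    memLp_one_iff_integrable.1 (memLp_smul_of_continuous hK hg (memLp_one_iff_integrable.2 h1))
  refine (integrableOn_iff_integrable_of_support_subset ?_).1 h2
  intro X hX
  by_contra h
  exact hX (by simp [h0 X h])

lemma IsTest.integrable_smul {E : Type*} [NormedAddCommGroup E] [NormedSpace ℝ E]
    {f : EuclideanSpace ℝ (Fin N) → E} (hφ : IsTest Ω φ)
    (hf : LocallyIntegrableOn f Ω volume) : Integrable (fun X => φ X • f X) volume :=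
  integrable_smul_of_tsupport_subset hf hφ.continuous hφ.2.1 hφ.2.2
    (fun _ hX => image_eq_zero_of_notMem_tsupport hX)

lemma IsTest.integrable_mul {f : EuclideanSpace ℝ (Fin N) → ℝ} (hφ : IsTest Ω φ)
    (hf : LocallyIntegrableOn f Ω volume) : Integrable (fun X => φ X * f X) volume :=
  hφ.integrable_smul hf

lemma IsTest.integrable_mul_fderiv {f : EuclideanSpace ℝ (Fin N) → ℝ} (hφ : IsTest Ω φ)
    (hf : LocallyIntegrableOn f Ω volume) (e : EuclideanSpace ℝ (Fin N)) :
    Integrable (fun X => f X * fderiv ℝ φ X e) volume := by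
  have := integrable_smul_of_tsupport_subset (g := fun X => fderiv ℝ φ X e) hf
    ((hφ.1.continuous_fderiv (by simp)).clm_apply continuous_const) hφ.2.1 hφ.2.2
    (fun _ hX => by simp [fderiv_zero_of_notMem_tsupport hX])
  simpa only [smul_eq_mul, mul_comm] using this

lemma IsTest.integrable_mul_inner (hφ : IsTest Ω φ)
    (hf : LocallyIntegrableOn G Ω volume) (e : EuclideanSpace ℝ (Fin N)) :
    Integrable (fun X => φ X * inner ℝ (G X) e) volume := by
  have := (hφ.integrable_smul hf).inner_const (𝕜 := ℝ) e
  simpa only [inner_smul_left, RCLike.conj_to_real] using this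

lemma IsTest.setIntegral_fderiv (hφ : IsTest Ω φ) (e : EuclideanSpace ℝ (Fin N)) :
    ∫ X in Ω, u X * fderiv ℝ φ X e = ∫ X, u X * fderiv ℝ φ X e :=
  setIntegral_eq_integral_of_forall_compl_eq_zero fun X hX => by
    rw [fderiv_zero_of_notMem_tsupport (fun h => hX (hφ.2.2 h))]; simp

lemma IsTest.setIntegral_inner (hφ : IsTest Ω φ) (e : EuclideanSpace ℝ (Fin N)) :
    ∫ X in Ω, φ X * inner ℝ (G X) e = ∫ X, φ X * inner ℝ (G X) e :=
  setIntegral_eq_integral_of_forall_compl_eq_zero fun X hX => by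
    rw [image_eq_zero_of_notMem_tsupport (fun h => hX (hφ.2.2 h)), zero_mul]

lemma HasWeakGradient.integral_eq (h : HasWeakGradient Ω u G) (hφ : IsTest Ω φ)
    (e : EuclideanSpace ℝ (Fin N)) :
    ∫ X, u X * fderiv ℝ φ X e = -∫ X, φ X * inner ℝ (G X) e := by
  rw [← hφ.setIntegral_fderiv e, ← hφ.setIntegral_inner e]
  exact h.2.2 φ hφ.1 hφ.2.1 hφ.2.2 e

lemma locallyIntegrableOn_of_memLp {E : Type*} [NormedAddCommGroup E]
    {f : EuclideanSpace ℝ (Fin N) → E} (hΩ : IsOpen Ω)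
    (h : ∀ K : Set (EuclideanSpace ℝ (Fin N)), IsCompact K → K ⊆ Ω →
      MemLp f 2 (volume.restrict K)) : LocallyIntegrableOn f Ω volume := by
  rw [locallyIntegrableOn_iff hΩ.isLocallyClosed]
  intro K hKΩ hK
  have : IsFiniteMeasure (volume.restrict K) := ⟨by simpa using hK.measure_lt_top⟩
  exact (h K hK hKΩ).integrable (by norm_num)

lemma IsH1.of_integral (hΩ : IsOpen Ω)
    (h : ∀ K : Set (EuclideanSpace ℝ (Fin N)), IsCompact K → K ⊆ Ω →
      MemLp u 2 (volume.restrict K) ∧ MemLp G 2 (volume.restrict K))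
    (hi : ∀ φ, IsTest Ω φ → ∀ e, ∫ X, u X * fderiv ℝ φ X e = -∫ X, φ X * inner ℝ (G X) e) :
    IsH1 Ω u G := by
  refine ⟨⟨locallyIntegrableOn_of_memLp hΩ fun K hK hKΩ => (h K hK hKΩ).1,
    locallyIntegrableOn_of_memLp hΩ fun K hK hKΩ => (h K hK hKΩ).2, ?_⟩, h⟩
  intro φ h1 h2 h3 e
  have hφ : IsTest Ω φ := ⟨h1, h2, h3⟩
  rw [hφ.setIntegral_fderiv e, hφ.setIntegral_inner e, hi φ hφ e]

lemma HasWeakGradient.mono (h : HasWeakGradient Ω u G) (hD : D ⊆ Ω) :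
    HasWeakGradient D u G := by
  refine ⟨h.1.mono_set hD, h.2.1.mono_set hD, ?_⟩
  intro φ h1 h2 h3 e
  have hφ : IsTest D φ := ⟨h1, h2, h3⟩
  rw [hφ.setIntegral_fderiv e, hφ.setIntegral_inner e, h.integral_eq (hφ.mono hD)]

lemma IsH1.mono (h : IsH1 Ω u G) (hD : D ⊆ Ω) : IsH1 D u G :=
  ⟨h.1.mono hD, fun K hK hKD => h.2 K hK (hKD.trans hD)⟩

/-- Weak gradients are unique. -/
lemma HasWeakGradient.ae_eq (hD : IsOpen D) (hu : HasWeakGradient D u G)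
    (hv : HasWeakGradient D v F) (huv : ∀ᵐ X ∂volume, X ∈ D → u X = v X) :
    ∀ᵐ X ∂volume, X ∈ D → G X = F X := by
  have key := hD.ae_eq_zero_of_integral_contDiff_smul_eq_zero (μ := volume)
    (f := fun X => G X - F X) (hu.2.1.sub hv.2.1) ?_
  · filter_upwards [key] with X hX hXD using sub_eq_zero.1 (hX hXD)
  intro φ h1 h2 h3
  have hφ : IsTest D φ := ⟨h1, h2, h3⟩
  have hi1 := hφ.integrable_smul hu.2.1
  have hi2 := hφ.integrable_smul hv.2.1
  refine ext_inner_right ℝ fun e => ?_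
  simp only [smul_sub]
  rw [integral_sub hi1 hi2, inner_sub_left, inner_zero_left, sub_eq_zero,
    real_inner_comm, ← integral_inner hi1, real_inner_comm, ← integral_inner hi2]
  have e1 := hu.integral_eq hφ e
  have e2 := hv.integral_eq hφ e
  have e3 : ∫ X, u X * fderiv ℝ φ X e = ∫ X, v X * fderiv ℝ φ X e := by
    refine integral_congr_ae ?_
    filter_upwards [huv] with X hX
    by_cases h : X ∈ D
    · rw [hX h]
    · rw [fderiv_zero_of_notMem_tsupport (fun h' => h (h3 h'))]; simp
  simp only [inner_smul_right]
  rw [e1, e2, neg_inj] at e3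
  simpa only [real_inner_comm e] using e3

lemma IsH1.add (hΩ : IsOpen Ω) (hu : IsH1 Ω u G) (hv : IsH1 Ω v F) :
    IsH1 Ω (fun X => u X + v X) (fun X => G X + F X) := by
  refine IsH1.of_integral hΩ
    (fun K hK hKΩ => ⟨(hu.2 K hK hKΩ).1.add (hv.2 K hK hKΩ).1,
      (hu.2 K hK hKΩ).2.add (hv.2 K hK hKΩ).2⟩) ?_
  intro φ hφ e
  simp only [add_mul, inner_add_left, mul_add]
  rw [integral_add (hφ.integrable_mul_fderiv hu.1.1 e) (hφ.integrable_mul_fderiv hv.1.1 e),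
    integral_add (hφ.integrable_mul_inner hu.1.2.1 e) (hφ.integrable_mul_inner hv.1.2.1 e),
    hu.1.integral_eq hφ, hv.1.integral_eq hφ, neg_add]

lemma IsH1.const_mul (hΩ : IsOpen Ω) (hu : IsH1 Ω u G) (c : ℝ) :
    IsH1 Ω (fun X => c * u X) (fun X => c • G X) := by
  refine IsH1.of_integral hΩ
    (fun K hK hKΩ => ⟨(hu.2 K hK hKΩ).1.const_mul c, (hu.2 K hK hKΩ).2.const_smul c⟩) ?_
  intro φ hφ e
  simp only [mul_assoc, inner_smul_left, RCLike.conj_to_real, mul_left_comm _ c]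
  rw [integral_const_mul, integral_const_mul, hu.1.integral_eq hφ, mul_neg]

lemma IsH1.sub (hΩ : IsOpen Ω) (hu : IsH1 Ω u G) (hv : IsH1 Ω v F) :
    IsH1 Ω (fun X => u X - v X) (fun X => G X - F X) := by
  have := hu.add hΩ (hv.const_mul hΩ (-1))
  simpa [sub_eq_add_neg] using this

lemma fderiv_mul_apply {φ ψ : EuclideanSpace ℝ (Fin N) → ℝ} (hφ : ContDiff ℝ ∞ φ)
    (hψ : ContDiff ℝ ∞ ψ) (X e : EuclideanSpace ℝ (Fin N)) :
    fderiv ℝ (fun X => φ X * ψ X) X e = φ X * fderiv ℝ ψ X e + ψ X * fderiv ℝ φ X e := by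
  rw [fderiv_fun_mul (hφ.differentiable (by simp) X) (hψ.differentiable (by simp) X)]
  simp

/-- The product rule for a smooth factor. -/
lemma IsH1.smooth_mul {η : EuclideanSpace ℝ (Fin N) → ℝ} (hΩ : IsOpen Ω)
    (hη : ContDiff ℝ ∞ η) (hu : IsH1 Ω u G) :
    IsH1 Ω (fun X => η X * u X) (fun X => η X • G X + u X • gradient η X) := by
  refine IsH1.of_integral hΩ
    (fun K hK hKΩ => ⟨memLp_smul_of_continuous hK hη.continuous (hu.2 K hK hKΩ).1,
      (memLp_smul_of_continuous hK hη.continuous (hu.2 K hK hKΩ).2).add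
      (memLp_smul_of_continuous' hK (continuous_gradient hη) (hu.2 K hK hKΩ).1)⟩) ?_
  intro φ hφ e
  have hφη : IsTest Ω (fun X => φ X * η X) :=
    ⟨hφ.1.mul hη, hφ.2.1.mul_right, (tsupport_mul_subset_left).trans hφ.2.2⟩
  have hc : Continuous fun X => fderiv ℝ η X e :=
    (hη.continuous_fderiv (by simp)).clm_apply continuous_const
  have h1 := hu.1.integral_eq hφη e
  have i1 : Integrable (fun X => φ X * (u X * fderiv ℝ η X e)) volume := by
    have := integrable_smul_of_tsupport_subset (g := fun X => φ X * fderiv ℝ η X e) hu.1.1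
      (hφ.continuous.mul hc) hφ.2.1 hφ.2.2
      (fun X hX => by simp [image_eq_zero_of_notMem_tsupport hX])
    refine this.congr (Eventually.of_forall fun X => ?_)
    simp only [smul_eq_mul]; ring
  have i2 : Integrable (fun X => η X * u X * fderiv ℝ φ X e) volume := by
    refine ((hφη.integrable_mul_fderiv hu.1.1 e).sub i1).congr
      (Eventually.of_forall fun X => ?_)
    simp only [Pi.sub_apply, fderiv_mul_apply hφ.1 hη]; ring
  have i3 := hφη.integrable_mul_inner hu.1.2.1 e
  have e1 : ∫ X, u X * fderiv ℝ (fun X => φ X * η X) X e =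
      (∫ X, φ X * (u X * fderiv ℝ η X e)) + ∫ X, η X * u X * fderiv ℝ φ X e := by
    rw [← integral_add i1 i2]
    refine integral_congr_ae (Eventually.of_forall fun X => ?_)
    simp only [fderiv_mul_apply hφ.1 hη]; ring
  have e2 : ∫ X, φ X * inner ℝ (η X • G X + u X • gradient η X) e =
      (∫ X, φ X * η X * inner ℝ (G X) e) + ∫ X, φ X * (u X * fderiv ℝ η X e) := by
    rw [← integral_add i3 i1]
    refine integral_congr_ae (Eventually.of_forall fun X => ?_)
    simp only [inner_add_left, inner_smul_left, RCLike.conj_to_real, fderiv_eq_inner_gradient]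
    ring
  rw [e2]
  linarith

lemma isH1_const (hΩ : IsOpen Ω) (c : ℝ) :
    IsH1 Ω (fun _ => c) (fun _ : EuclideanSpace ℝ (Fin N) => 0) := by
  refine IsH1.of_integral hΩ (fun K hK hKΩ => ?_) ?_
  · have : IsFiniteMeasure (volume.restrict K) := ⟨by simpa using hK.measure_lt_top⟩
    exact ⟨memLp_const c, memLp_const 0⟩
  · intro φ hφ e
    have h := integral_mul_fderiv_eq_neg_fderiv_mul_of_integrable (μ := volume) (v := e)
      (f := fun _ : EuclideanSpace ℝ (Fin N) => c) (g := φ) (by simp)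
      ((hφ.integrable_mul_fderiv (continuous_const.locallyIntegrable.locallyIntegrableOn Ω) e))
      (by simpa [mul_comm] using
        (hφ.integrable_mul (continuous_const.locallyIntegrable.locallyIntegrableOn Ω)))
      (fun X _ => differentiableAt_const c) (fun X _ => hφ.1.differentiable (by simp) X)
    rw [h]; simp

lemma isH1_smooth {η : EuclideanSpace ℝ (Fin N) → ℝ} (hΩ : IsOpen Ω) (hη : ContDiff ℝ ∞ η) :
    IsH1 Ω η (gradient η) := by
  simpa using IsH1.smooth_mul hΩ hη (isH1_const hΩ 1)

/-- Uniqueness of weak gradients makes the arbitrary choice inside `weakGrad` irrelevant, so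
energies can be computed with any explicit gradient. -/
lemma lintegral_weakGrad (hD : IsOpen D) (h : HasWeakGradient D u G) :
    ∫⁻ X in D, ‖weakGrad D u X‖ₑ ^ 2 = ∫⁻ X in D, ‖G X‖ₑ ^ 2 := by
  have hex : ∃ G, HasWeakGradient D u G := ⟨G, h⟩
  have h' : HasWeakGradient D u (weakGrad D u) := by
    rw [weakGrad, dif_pos hex]; exact Classical.choose_spec hex
  refine lintegral_congr_ae ?_
  rw [EventuallyEq, ae_restrict_iff' hD.measurableSet]
  filter_upwards [h'.ae_eq hD h (Eventually.of_forall fun _ _ => rfl)] with X hX hXD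
  rw [hX hXD]

/-! ### Precise values: order, locality, additivity -/

section PreciseValues

variable {N : ℕ} {W : Set (EuclideanSpace ℝ (Fin N))} {u v : EuclideanSpace ℝ (Fin N) → ℝ}
  {X : EuclideanSpace ℝ (Fin N)} {a b : ℝ}

lemma eventually_closedBall_subset (hW : IsOpen W) (hX : X ∈ W) :
    ∀ᶠ r : ℝ in 𝓝[>] 0, Metric.closedBall X r ⊆ W := by
  obtain ⟨ε, hε, h⟩ := Metric.nhds_basis_closedBall.mem_iff.1 (hW.mem_nhds hX)
  filter_upwards [Ioo_mem_nhdsGT hε] with r hr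
  exact (Metric.closedBall_subset_closedBall hr.2.le).trans h

lemma integrableOn_ball (hu : LocallyIntegrableOn u W volume) {r : ℝ}
    (hr : Metric.closedBall X r ⊆ W) : IntegrableOn u (Metric.ball X r) volume :=
  (hu.integrableOn_compact_subset hr (isCompact_closedBall X r)).mono_set
    Metric.ball_subset_closedBall

lemma HasPreciseValue.le (hW : IsOpen W) (hX : X ∈ W) (hv : LocallyIntegrableOn v W volume)
    (hu : LocallyIntegrableOn u W volume) (hvu : ∀ᵐ Y ∂volume, Y ∈ W → v Y ≤ u Y)
    (ha : HasPreciseValue v X a) (hb : HasPreciseValue u X b) : a ≤ b := by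
  refine le_of_tendsto_of_tendsto ha hb ?_
  filter_upwards [eventually_closedBall_subset hW hX] with r hr
  rw [setAverage_eq, setAverage_eq]
  refine smul_le_smul_of_nonneg_left ?_ (by positivity)
  refine setIntegral_mono_ae_restrict (integrableOn_ball hv hr) (integrableOn_ball hu hr) ?_
  rw [EventuallyLE, ae_restrict_iff' Metric.isOpen_ball.measurableSet]
  filter_upwards [hvu] with Y hY hYb using hY (hr (Metric.ball_subset_closedBall hYb))

/-- Averages over small balls see only the almost everywhere class near the point. This is how
almost everywhere equality in an open set controls traces on the null hyperplane. -/
lemma hasPreciseValue_congr (hW : IsOpen W) (hX : X ∈ W)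
    (hvu : ∀ᵐ Y ∂volume, Y ∈ W → v Y = u Y) : HasPreciseValue v X a ↔ HasPreciseValue u X a := by
  refine tendsto_congr' ?_
  filter_upwards [eventually_closedBall_subset hW hX] with r hr
  rw [setAverage_eq, setAverage_eq]
  congr 1
  refine setIntegral_congr_ae Metric.isOpen_ball.measurableSet ?_
  filter_upwards [hvu] with Y hY hYb using hY (hr (Metric.ball_subset_closedBall hYb))

lemma HasPreciseValue.add (hW : IsOpen W) (hX : X ∈ W) (hv : LocallyIntegrableOn v W volume)
    (hu : LocallyIntegrableOn u W volume) (ha : HasPreciseValue v X a)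
    (hb : HasPreciseValue u X b) : HasPreciseValue (fun Y => v Y + u Y) X (a + b) := by
  refine (Tendsto.add ha hb).congr' ?_
  filter_upwards [eventually_closedBall_subset hW hX] with r hr
  rw [setAverage_eq, setAverage_eq, setAverage_eq, ← smul_add,
    integral_add (integrableOn_ball hv hr) (integrableOn_ball hu hr)]

end PreciseValues

/-! ### The hyperplane embedding -/

section Thin

variable {n : ℕ}

lemma thin_apply_castSucc (x : EuclideanSpace ℝ (Fin n)) (i : Fin n) :
    thin x i.castSucc = x i := by simp [thin]

lemma thin_apply_last (x : EuclideanSpace ℝ (Fin n)) : thin x (Fin.last n) = 0 := by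
  simp [thin]

lemma isometry_thin : Isometry (thin (n := n)) := by
  refine Isometry.of_dist_eq fun x y => ?_
  rw [EuclideanSpace.dist_eq, EuclideanSpace.dist_eq, Fin.sum_univ_castSucc]
  simp [thin_apply_castSucc, thin_apply_last]

lemma thin_surj {X : EuclideanSpace ℝ (Fin (n + 1))} (h : X (Fin.last n) = 0) :
    ∃ x, thin x = X := by
  refine ⟨WithLp.toLp 2 fun i => X i.castSucc, ?_⟩
  ext i
  refine Fin.lastCases ?_ (fun i => ?_) i
  · rw [thin_apply_last, h]
  · rw [thin_apply_castSucc]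

lemma continuous_thin : Continuous (thin (n := n)) := isometry_thin.continuous

lemma volume_slice_lt_top {D : Set (EuclideanSpace ℝ (Fin (n + 1)))}
    (hD : Bornology.IsBounded D) : volume {x | thin x ∈ D} < ⊤ :=
  (isometry_thin.antilipschitz.isBounded_preimage hD).measure_lt_top

lemma volume_thinPositive_ne_top {D : Set (EuclideanSpace ℝ (Fin (n + 1)))}
    {u : EuclideanSpace ℝ (Fin (n + 1)) → ℝ}
    (hD : Bornology.IsBounded D) : volume (thinPositive u D) ≠ ⊤ :=
  ((measure_mono fun _ h => h.1).trans_lt (volume_slice_lt_top hD)).ne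

end Thin

/-! ### The energy as a real number -/

section Energy

variable {N n : ℕ}

lemma ofReal_integral_norm_sq {E : Type*} [NormedAddCommGroup E]
    {D : Set (EuclideanSpace ℝ (Fin N))}
    {G : EuclideanSpace ℝ (Fin N) → E} (hG : MemLp G 2 (volume.restrict D)) :
    ∫⁻ X in D, ‖G X‖ₑ ^ 2 = ENNReal.ofReal (∫ X in D, ‖G X‖ ^ 2) := by
  rw [ofReal_integral_eq_lintegral_ofReal hG.norm.integrable_sq
    (Eventually.of_forall fun X => by positivity)]
  refine lintegral_congr fun X => ?_
  rw [ENNReal.ofReal_pow (norm_nonneg _), ofReal_norm]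

lemma integrable_inner_of_memLp {D : Set (EuclideanSpace ℝ (Fin N))}
    {G F : EuclideanSpace ℝ (Fin N) → EuclideanSpace ℝ (Fin N)}
    (hG : MemLp G 2 (volume.restrict D)) (hF : MemLp F 2 (volume.restrict D)) :
    Integrable (fun X => inner ℝ (G X) (F X)) (volume.restrict D) := by
  refine (hG.norm.integrable_mul hF.norm).mono' (hG.1.inner hF.1) (Eventually.of_forall fun X => ?_)
  exact norm_inner_le_norm _ _

/-- `D ⊂⊂ Ω` is a domain. -/
structure IsSubdomain (Ω D : Set (EuclideanSpace ℝ (Fin N))) : Prop where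
  isOpen : IsOpen D
  isConnected : IsConnected D
  isCompact : IsCompact (closure D)
  subset : closure D ⊆ Ω

variable {Ω D K : Set (EuclideanSpace ℝ (Fin N))} {u v ψ : EuclideanSpace ℝ (Fin N) → ℝ}
  {G F H : EuclideanSpace ℝ (Fin N) → EuclideanSpace ℝ (Fin N)}

lemma isSubdomain_ball {X : EuclideanSpace ℝ (Fin N)} {r : ℝ} (hr : 0 < r)
    (h : Metric.closedBall X r ⊆ Ω) : IsSubdomain Ω (Metric.ball X r) where
  isOpen := Metric.isOpen_ball
  isConnected := ⟨⟨X, Metric.mem_ball_self hr⟩, (convex_ball X r).isPreconnected⟩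
  isCompact := (isCompact_closedBall X r).of_isClosed_subset isClosed_closure
    Metric.closure_ball_subset_closedBall
  subset := Metric.closure_ball_subset_closedBall.trans h

lemma IsSubdomain.self_subset (hD : IsSubdomain Ω D) : D ⊆ Ω := subset_closure.trans hD.subset

lemma IsSubdomain.isBounded (hD : IsSubdomain Ω D) : Bornology.IsBounded D :=
  hD.isCompact.isBounded.subset subset_closure

lemma IsH1.memLp (h : IsH1 Ω u G) (hD : IsSubdomain Ω D) :
    MemLp u 2 (volume.restrict D) ∧ MemLp G 2 (volume.restrict D) :=
  ⟨(h.2 _ hD.isCompact hD.subset).1.mono_measure (Measure.restrict_mono subset_closure le_rfl),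
    (h.2 _ hD.isCompact hD.subset).2.mono_measure (Measure.restrict_mono subset_closure le_rfl)⟩

/-- On $D\subset\subset\Omega$ both terms are finite, so comparisons of energies can be carried out
in `ℝ`, where common terms cancel. The positivity set of a competitor need not be known to be
measurable. -/
lemma energy_eq {Ω D : Set (EuclideanSpace ℝ (Fin (n + 1)))}
    {u : EuclideanSpace ℝ (Fin (n + 1)) → ℝ}
    {G : EuclideanSpace ℝ (Fin (n + 1)) → EuclideanSpace ℝ (Fin (n + 1))}
    (hD : IsSubdomain Ω D) (h : IsH1 Ω u G) :
    energy u D = ENNReal.ofReal ((∫ X in D, ‖G X‖ ^ 2) + volume.real (thinPositive u D)) := by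
  rw [energy, lintegral_weakGrad hD.isOpen (h.1.mono hD.self_subset),
    ofReal_integral_norm_sq (h.memLp hD).2, ENNReal.ofReal_add (by positivity) (by positivity),
    ofReal_measureReal (volume_thinPositive_ne_top hD.isBounded)]

lemma energy_le_energy_iff {Ω D : Set (EuclideanSpace ℝ (Fin (n + 1)))}
    {u v : EuclideanSpace ℝ (Fin (n + 1)) → ℝ}
    {G F : EuclideanSpace ℝ (Fin (n + 1)) → EuclideanSpace ℝ (Fin (n + 1))}
    (hD : IsSubdomain Ω D) (hu : IsH1 Ω u G) (hv : IsH1 Ω v F) :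
    energy u D ≤ energy v D ↔
      (∫ X in D, ‖G X‖ ^ 2) + volume.real (thinPositive u D) ≤
        (∫ X in D, ‖F X‖ ^ 2) + volume.real (thinPositive v D) := by
  rw [energy_eq hD hu, energy_eq hD hv, ENNReal.ofReal_le_ofReal_iff (by positivity)]

end Energy

/-! ### First variations and weak (sub)harmonicity -/

section Minimality

variable {n : ℕ} {Ω D K : Set (EuclideanSpace ℝ (Fin (n + 1)))}
  {u v ψ : EuclideanSpace ℝ (Fin (n + 1)) → ℝ}
  {G F : EuclideanSpace ℝ (Fin (n + 1)) → EuclideanSpace ℝ (Fin (n + 1))}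

/-- The complement of a compact $K\subseteq D$ is an open neighborhood of $\Omega\setminus D$, so
compactly supported perturbations are admissible. -/
lemma IsLocalMinimizer.energy_le (h : IsLocalMinimizer Ω u) (hD : IsSubdomain Ω D)
    (hu : IsH1 Ω u G) (hv : IsH1 Ω v F) (hK : IsCompact K) (hKD : K ⊆ D)
    (hvu : ∀ X ∈ Ω, X ∉ K → v X = u X) :
    (∫ X in D, ‖G X‖ ^ 2) + volume.real (thinPositive u D) ≤
      (∫ X in D, ‖F X‖ ^ 2) + volume.real (thinPositive v D) := by
  rw [← energy_le_energy_iff hD hu hv]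
  exact h.2 D hD.isOpen hD.isConnected hD.isCompact hD.subset v ⟨F, hv⟩
    ⟨Kᶜ, hK.isClosed.isOpen_compl, fun X hX hXK => hX.2 (hKD hXK),
      Eventually.of_forall fun X hX => hvu X hX.1 hX.2⟩

lemma nonneg_of_mul_add_sq {a b : ℝ} (h : ∀ t : ℝ, 0 < t → t ≤ 1 → 0 ≤ 2 * t * a + t ^ 2 * b) :
    0 ≤ a := by
  have h1 : Tendsto (fun t : ℝ => 2 * a + t * b) (𝓝[>] 0) (𝓝 (2 * a + 0 * b)) := by
    refine Tendsto.mono_left (Continuous.tendsto ?_ 0) nhdsWithin_le_nhds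
    fun_prop
  have h2 : 0 ≤ 2 * a + 0 * b := by
    refine ge_of_tendsto h1 ?_
    filter_upwards [Ioc_mem_nhdsGT (zero_lt_one' ℝ)] with t ht
    have := h t ht.1 ht.2
    have h3 : 0 ≤ t * (2 * a + t * b) := by linarith
    exact nonneg_of_mul_nonneg_right h3 ht.1
  linarith

/-- First variation of the energy in directions that do not enlarge the positivity set. -/
lemma IsLocalMinimizer.integral_inner_nonneg (h : IsLocalMinimizer Ω u) (hΩ : IsOpen Ω)
    (hD : IsSubdomain Ω D) (hu : IsH1 Ω u G) (hψ : IsH1 Ω ψ F) (hK : IsCompact K) (hKD : K ⊆ D)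
    (h0 : ∀ X ∉ K, ψ X = 0)
    (hpos : ∀ t : ℝ, 0 < t → thinPositive (fun X => u X + t * ψ X) D ⊆ thinPositive u D) :
    0 ≤ ∫ X in D, inner ℝ (G X) (F X) := by
  refine nonneg_of_mul_add_sq (b := ∫ X in D, ‖F X‖ ^ 2) fun t ht _ => ?_
  have h1 := h.energy_le hD hu (hu.add hΩ (hψ.const_mul hΩ t)) hK hKD
    (fun X _ hX => by simp [h0 X hX])
  -- The area term can only drop, so it leaves the comparison and only the quadratic expansion of
  -- the Dirichlet term in $t$ remains.
  have h2 : volume.real (thinPositive (fun X => u X + t * ψ X) D) ≤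
      volume.real (thinPositive u D) :=
    measureReal_mono (hpos t ht) (volume_thinPositive_ne_top hD.isBounded)
  have hG := (hu.memLp hD).2
  have hF := (hψ.memLp hD).2
  have iG : Integrable (fun X => ‖G X‖ ^ 2) (volume.restrict D) := hG.norm.integrable_sq
  have iF : Integrable (fun X => ‖F X‖ ^ 2) (volume.restrict D) := hF.norm.integrable_sq
  have iGF : Integrable (fun X => inner ℝ (G X) (F X)) (volume.restrict D) :=
    integrable_inner_of_memLp hG hF
  have i2 : Integrable (fun X => 2 * t * inner ℝ (G X) (F X) + t ^ 2 * ‖F X‖ ^ 2)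
    (volume.restrict D) := (iGF.const_mul _).add (iF.const_mul _)
  have h3 : ∫ X in D, ‖G X + t • F X‖ ^ 2 =
      (∫ X in D, ‖G X‖ ^ 2) + (2 * t * (∫ X in D, inner ℝ (G X) (F X)) +
        t ^ 2 * ∫ X in D, ‖F X‖ ^ 2) := by
    rw [← integral_const_mul, ← integral_const_mul,
      ← integral_add (iGF.const_mul _) (iF.const_mul _),
      ← integral_add iG i2]
    refine integral_congr_ae (Eventually.of_forall fun X => ?_)
    simp only [norm_add_sq_real, inner_smul_right, norm_smul, mul_pow, Real.norm_eq_abs, sq_abs]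
    ring
  linarith

lemma IsMinimizer.thinPositive_eq (h : IsMinimizer Ω u) (hDΩ : D ⊆ Ω) :
    thinPositive u D = {x | thin x ∈ D ∧ 0 < u (thin x)} := by
  ext x
  refine ⟨fun ⟨hx, a, ha, hax⟩ => ⟨hx, ?_⟩, fun ⟨hx, hx'⟩ => ⟨hx, _, hx', h.precise _ (hDΩ hx)⟩⟩
  have := tendsto_nhds_unique hax (h.precise _ (hDΩ hx))
  exact this ▸ ha

lemma thinPositive_subset_of_le (hΩ : IsOpen Ω) (hDΩ : D ⊆ Ω) (hu : IsMinimizer Ω u)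
    (hu' : IsH1 Ω u G) (hv : IsH1 Ω v F) (hvu : ∀ X ∈ Ω, v X ≤ u X) :
    thinPositive v D ⊆ thinPositive u D := by
  rintro x ⟨hx, a, ha, hax⟩
  refine ⟨hx, _, ha.trans_le ?_, hu.precise _ (hDΩ hx)⟩
  exact HasPreciseValue.le hΩ (hDΩ hx) hv.1.1 hu'.1.1 (Eventually.of_forall hvu) hax
    (hu.precise _ (hDΩ hx))

/-- Minimizers are weakly subharmonic. -/
lemma IsMinimizer.integral_inner_nonpos (h : IsMinimizer Ω u) (hΩ : IsOpen Ω)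
    (hD : IsSubdomain Ω D) (hu : IsH1 Ω u G) (hψ : IsH1 Ω ψ F) (hK : IsCompact K) (hKD : K ⊆ D)
    (h0 : ∀ X ∉ K, ψ X = 0) (hψ0 : ∀ X ∈ Ω, 0 ≤ ψ X) :
    ∫ X in D, inner ℝ (G X) (F X) ≤ 0 := by
  have h1 := h.minimizes.integral_inner_nonneg hΩ hD hu (hψ.const_mul hΩ (-1)) hK hKD
    (fun X hX => by simp [h0 X hX]) ?_
  · simpa [integral_neg] using h1
  · intro t ht
    refine thinPositive_subset_of_le hΩ hD.self_subset h hu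
      (hu.add hΩ ((hψ.const_mul hΩ (-1)).const_mul hΩ t)) fun X hX => ?_
    nlinarith [hψ0 X hX]

/-- Minimizers are weakly harmonic where they are positive on the hyperplane. -/
lemma IsMinimizer.integral_inner_eq_zero (h : IsMinimizer Ω u) (hΩ : IsOpen Ω)
    (hD : IsSubdomain Ω D) (hu : IsH1 Ω u G) (hpos : ∀ x, thin x ∈ D → 0 < u (thin x))
    {φ : EuclideanSpace ℝ (Fin (n + 1)) → ℝ} (hφ : IsTest D φ) :
    ∫ X in D, inner ℝ (G X) (gradient φ X) = 0 := by
  -- The positivity set of `u` already fills the slice of `D`, so no competitor can enlarge it and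
  -- both signs of the variation are allowed.
  have hs : ∀ v, thinPositive v D ⊆ thinPositive u D := fun v x hx =>
    ⟨hx.1, _, hpos x hx.1, h.precise _ (hD.self_subset hx.1)⟩
  have h1 := h.minimizes.integral_inner_nonneg hΩ hD hu (isH1_smooth hΩ hφ.1) hφ.2.1 hφ.2.2
    (fun X hX => image_eq_zero_of_notMem_tsupport hX) (fun _ _ => hs _)
  have h2 := h.minimizes.integral_inner_nonneg hΩ hD hu
    ((isH1_smooth hΩ hφ.1).const_mul hΩ (-1)) hφ.2.1 hφ.2.2
    (fun X hX => by simp [image_eq_zero_of_notMem_tsupport hX]) (fun _ _ => hs _)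
  simp only [inner_smul_right, neg_mul, one_mul, integral_neg] at h2
  linarith

end Minimality

/-! ### Caccioppoli inequality and the Cauchy estimate for gradients -/

section Estimates

variable {n : ℕ} {Ω : Set (EuclideanSpace ℝ (Fin (n + 1)))}

/-- A smooth cutoff between two concentric balls. -/
lemma exists_ball_cutoff {N : ℕ} (x : EuclideanSpace ℝ (Fin N)) {r R : ℝ} (hr : 0 < r)
    (hrR : r < R) : ∃ φ : EuclideanSpace ℝ (Fin N) → ℝ, ∃ K M, ContDiff ℝ ∞ φ ∧ IsCompact K ∧
      K ⊆ Metric.ball x R ∧ tsupport φ ⊆ K ∧ (∀ X, 0 ≤ φ X) ∧ (∀ X, φ X ≤ 1) ∧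
      (∀ X ∈ Metric.closedBall x r, φ X = 1) ∧ 0 ≤ M ∧ ∀ X, ‖gradient φ X‖ ≤ M := by
  let b : ContDiffBump x := ⟨r, (r + R) / 2, hr, by linarith⟩
  have hb : ContDiff ℝ ∞ (b : EuclideanSpace ℝ (Fin N) → ℝ) := b.contDiff
  have hs : HasCompactSupport (gradient (b : EuclideanSpace ℝ (Fin N) → ℝ)) :=
    HasCompactSupport.intro (K := Metric.closedBall x ((r + R) / 2)) (isCompact_closedBall _ _)
      fun X hX => gradient_zero_of_notMem_tsupport (by rwa [b.tsupport_eq])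
  obtain ⟨M, hM⟩ := hs.exists_bound_of_continuous (continuous_gradient hb)
  refine ⟨b, Metric.closedBall x ((r + R) / 2), M, hb, isCompact_closedBall _ _,
    Metric.closedBall_subset_ball (by linarith), b.tsupport_eq.le, fun X => b.nonneg,
    fun X => b.le_one, fun X hX => b.one_of_mem_closedBall hX, (norm_nonneg _).trans (hM x), hM⟩

lemma setIntegral_le_of_indicator_le {N : ℕ} {A D : Set (EuclideanSpace ℝ (Fin N))}
    {f g : EuclideanSpace ℝ (Fin N) → ℝ} (hA : MeasurableSet A) (hAD : A ⊆ D)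
    (hD : MeasurableSet D) (hf : IntegrableOn f D volume) (hg : IntegrableOn g D volume)
    (hfg : ∀ X ∈ D, A.indicator f X ≤ g X) : ∫ X in A, f X ≤ ∫ X in D, g X := by
  have h1 : ∫ X in A, f X = ∫ X in D, A.indicator f X := by
    rw [setIntegral_indicator hA, Set.inter_eq_right.2 hAD]
  rw [h1]
  exact setIntegral_mono_on (hf.indicator hA) hg hD hfg

/-- With $G=\nabla u$ and $V=\nabla\varphi$ the second factor is $\nabla(\varphi^2u)$. The cross
term $4\varphi u\langle G,V\rangle$ is absorbed by expanding $(|\varphi||G|-2|u|M)^2\ge0$. -/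
lemma caccioppoli_pointwise (G V : EuclideanSpace ℝ (Fin (n + 1))) (u φ M : ℝ) (hV : ‖V‖ ≤ M)  :
    φ ^ 2 * ‖G‖ ^ 2 - 4 * M ^ 2 * u ^ 2 ≤
      2 * inner ℝ G (φ • (φ • G + u • V) + (φ * u) • V) := by
  have h1 := abs_real_inner_le_norm G V
  simp only [inner_add_right, inner_smul_right, real_inner_self_eq_norm_sq]
  have h2 : -(‖φ‖ * ‖G‖ * (‖u‖ * M)) ≤ φ * u * inner ℝ G V := by
    have : |φ * u * inner ℝ G V| ≤ ‖φ‖ * ‖G‖ * (‖u‖ * M) := by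
      rw [abs_mul, abs_mul]
      calc |φ| * |u| * |inner ℝ G V| ≤ |φ| * |u| * (‖G‖ * M) := by
            gcongr
            exact h1.trans (by gcongr)
        _ = _ := by simp only [Real.norm_eq_abs]; ring
    exact neg_le_of_abs_le this
  have h3 := sq_nonneg (‖φ‖ * ‖G‖ - 2 * (‖u‖ * M))
  have h4 : ‖φ‖ ^ 2 = φ ^ 2 := by simp
  have h5 : ‖u‖ ^ 2 = u ^ 2 := by simp
  nlinarith

/-- The Caccioppoli inequality. -/
lemma exists_caccioppoli (x : EuclideanSpace ℝ (Fin (n + 1))) {r R : ℝ} (hr : 0 < r)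
    (hrR : r < R) (hΩ : IsOpen Ω) (hR : Metric.closedBall x R ⊆ Ω) : ∃ C : ℝ, 0 ≤ C ∧
    ∀ u G, IsMinimizer Ω u → IsH1 Ω u G →
      ∫ X in Metric.ball x r, ‖G X‖ ^ 2 ≤ C * ∫ X in Metric.ball x R, u X ^ 2 := by
  obtain ⟨φ, K, M, hφ, hK, hKb, hsupp, hφ0, hφ1, hφr, hM0, hM⟩ := exists_ball_cutoff x hr hrR
  refine ⟨4 * M ^ 2, by positivity, fun u G hu huG => ?_⟩
  have hD : IsSubdomain Ω (Metric.ball x R) := isSubdomain_ball (hr.trans hrR) hR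
  -- The test function is $\varphi^2u\ge0$, built as $\varphi(\varphi u)$ so that its gradient has
  -- the form in `caccioppoli_pointwise`.
  have hψ := (huG.smooth_mul hΩ hφ).smooth_mul hΩ hφ
  have hzero : ∀ X ∉ K, φ X = 0 := fun X hX =>
    image_eq_zero_of_notMem_tsupport fun h => hX (hsupp h)
  have h1 := hu.integral_inner_nonpos hΩ hD huG hψ hK hKb
    (fun X hX => by simp [hzero X hX]) (fun X hX => by
      have := hu.nonneg X hX; have := hφ0 X; positivity)
  have mG := (huG.memLp hD).2
  have iG : IntegrableOn (fun X => ‖G X‖ ^ 2) (Metric.ball x R) volume := mG.norm.integrable_sq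
  have iu : IntegrableOn (fun X => u X ^ 2) (Metric.ball x R) volume :=
    (huG.memLp hD).1.integrable_sq
  have iGF := integrable_inner_of_memLp mG (hψ.memLp hD).2
  have h2 := setIntegral_le_of_indicator_le (A := Metric.ball x r) (D := Metric.ball x R)
    (f := fun X => ‖G X‖ ^ 2) Metric.isOpen_ball.measurableSet
    (Metric.ball_subset_ball hrR.le) Metric.isOpen_ball.measurableSet iG
    ((iGF.const_mul 2).add (iu.const_mul (4 * M ^ 2))) ?_
  · refine h2.trans ?_
    simp only [Pi.add_apply]
    rw [integral_add (iGF.const_mul 2) (iu.const_mul _), integral_const_mul, integral_const_mul]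
    linarith
  · intro X hX
    have h3 := caccioppoli_pointwise (G X) (gradient φ X) (u X) (φ X) M (hM X)
    have h4 : (Metric.ball x r).indicator (fun X => ‖G X‖ ^ 2) X ≤ φ X ^ 2 * ‖G X‖ ^ 2 := by
      by_cases h : X ∈ Metric.ball x r
      · rw [Set.indicator_of_mem h, hφr X (Metric.ball_subset_closedBall h)]; simp
      · rw [Set.indicator_of_notMem h]; positivity
    simp only [Pi.add_apply]
    linarith

/-- The right side is the sum of the first variations in the directions $\eta(\delta\mp w)$; the
zeros are the gradient of the constant $\delta$. The terms with $\eta$ add up to $\eta|G_1-G_2|^2$.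
The rest is small because $0\le\delta\mp w\le2\delta$ and $2|G|\le1+|G|^2$. -/
lemma cauchy_pointwise (G₁ G₂ V : EuclideanSpace ℝ (Fin (n + 1))) (w δ η M : ℝ) (hV : ‖V‖ ≤ M)
    (hw : |w| ≤ δ) :
    η * ‖G₁ - G₂‖ ^ 2 - δ * M * (2 + ‖G₁‖ ^ 2 + ‖G₂‖ ^ 2) ≤
      inner ℝ G₁ (η • (0 - (G₂ - G₁)) + (δ - w) • V) +
        inner ℝ G₂ (η • (0 + (G₂ - G₁)) + (δ + w) • V) := by
  have e : inner ℝ G₁ (η • (0 - (G₂ - G₁)) + (δ - w) • V) +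
        inner ℝ G₂ (η • (0 + (G₂ - G₁)) + (δ + w) • V) =
      η * ‖G₁ - G₂‖ ^ 2 + (δ - w) * inner ℝ G₁ V + (δ + w) * inner ℝ G₂ V := by
    rw [norm_sub_sq_real]
    simp only [inner_add_right, inner_smul_right, inner_sub_right, real_inner_self_eq_norm_sq,
      inner_zero_right, real_inner_comm G₁ G₂]
    ring
  have hM : 0 ≤ M := (norm_nonneg _).trans hV
  have hδ : 0 ≤ δ := (abs_nonneg _).trans hw
  have b : ∀ G : EuclideanSpace ℝ (Fin (n + 1)), ∀ c : ℝ, 0 ≤ c → c ≤ 2 * δ →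
      -(δ * M * (1 + ‖G‖ ^ 2)) ≤ c * inner ℝ G V := by
    intro G c hc hc'
    have h1 : |inner ℝ G V| ≤ ‖G‖ * M := (abs_real_inner_le_norm G V).trans (by gcongr)
    have h2 : |c * inner ℝ G V| ≤ δ * M * (1 + ‖G‖ ^ 2) := by
      rw [abs_mul, abs_of_nonneg hc]
      calc c * |inner ℝ G V| ≤ (2 * δ) * (‖G‖ * M) := by gcongr
        _ = δ * M * (2 * ‖G‖) := by ring
        _ ≤ _ := by gcongr; nlinarith [sq_nonneg (‖G‖ - 1)]
    exact neg_le_of_abs_le h2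
  have hw' := abs_le.1 hw
  have b1 := b G₁ (δ - w) (by linarith) (by linarith)
  have b2 := b G₂ (δ + w) (by linarith) (by linarith)
  rw [e]
  linarith

/-- The gradients of two uniformly close minimizers are close. -/
lemma exists_cauchy_estimate (x : EuclideanSpace ℝ (Fin (n + 1))) {r R : ℝ} (hr : 0 < r)
    (hrR : r < R) (hΩ : IsOpen Ω) (hR : Metric.closedBall x R ⊆ Ω) : ∃ C : ℝ, 0 ≤ C ∧
    ∀ u₁ u₂ G₁ G₂ δ, IsMinimizer Ω u₁ → IsMinimizer Ω u₂ → IsH1 Ω u₁ G₁ → IsH1 Ω u₂ G₂ →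
      (∀ X ∈ Metric.ball x R, |u₂ X - u₁ X| ≤ δ) →
      ∫ X in Metric.ball x r, ‖G₁ X - G₂ X‖ ^ 2 ≤
        δ * (C * ∫ X in Metric.ball x R, (2 + ‖G₁ X‖ ^ 2 + ‖G₂ X‖ ^ 2)) := by
  obtain ⟨η, K, M, hη, hK, hKb, hsupp, hη0, hη1, hηr, hM0, hM⟩ := exists_ball_cutoff x hr hrR
  refine ⟨M, hM0, fun u₁ u₂ G₁ G₂ δ hu₁ hu₂ h₁ h₂ hδ => ?_⟩
  have hD : IsSubdomain Ω (Metric.ball x R) := isSubdomain_ball (hr.trans hrR) hR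
  have hw := h₂.sub hΩ h₁
  have hψ₁ := ((isH1_const hΩ δ).sub hΩ hw).smooth_mul hΩ hη
  have hψ₂ := ((isH1_const hΩ δ).add hΩ hw).smooth_mul hΩ hη
  have hzero : ∀ X ∉ K, η X = 0 := fun X hX =>
    image_eq_zero_of_notMem_tsupport fun h => hX (hsupp h)
  -- The bound by $\delta$ is known only in the ball, but elsewhere $\eta=0$, so both test functions
  -- are nonnegative on all of $\Omega$.
  have hin : ∀ X, η X = 0 ∨ |u₂ X - u₁ X| ≤ δ := fun X => by
    by_cases h : X ∈ K
    · exact Or.inr (hδ X (hKb h))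
    · exact Or.inl (hzero X h)
  have e₁ := hu₁.integral_inner_nonpos hΩ hD h₁ hψ₁ hK hKb
    (fun X hX => by simp [hzero X hX]) (fun X hX => by
      rcases hin X with h | h
      · simp [h]
      · exact mul_nonneg (hη0 X) (by linarith [abs_le.1 h]))
  have e₂ := hu₂.integral_inner_nonpos hΩ hD h₂ hψ₂ hK hKb
    (fun X hX => by simp [hzero X hX]) (fun X hX => by
      rcases hin X with h | h
      · simp [h]
      · exact mul_nonneg (hη0 X) (by linarith [abs_le.1 h]))
  have m₁ := (h₁.memLp hD).2
  have m₂ := (h₂.memLp hD).2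
  have i₁ := integrable_inner_of_memLp m₁ (hψ₁.memLp hD).2
  have i₂ := integrable_inner_of_memLp m₂ (hψ₂.memLp hD).2
  have : IsFiniteMeasure (volume.restrict (Metric.ball x R)) :=
    ⟨by simpa using measure_ball_lt_top⟩
  have i₃ : IntegrableOn (fun X => 2 + ‖G₁ X‖ ^ 2 + ‖G₂ X‖ ^ 2) (Metric.ball x R) volume :=
    ((integrable_const 2).add m₁.norm.integrable_sq).add m₂.norm.integrable_sq
  have iW : IntegrableOn (fun X => ‖G₁ X - G₂ X‖ ^ 2) (Metric.ball x R) volume :=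
    (m₁.sub m₂).norm.integrable_sq
  have key := setIntegral_le_of_indicator_le (A := Metric.ball x r) (D := Metric.ball x R)
    (f := fun X => ‖G₁ X - G₂ X‖ ^ 2) Metric.isOpen_ball.measurableSet
    (Metric.ball_subset_ball hrR.le) Metric.isOpen_ball.measurableSet iW
    ((i₁.add i₂).add (i₃.const_mul (δ * M))) ?_
  · rw [integral_add' (i₁.add i₂) (i₃.const_mul (δ * M)), integral_add' i₁ i₂,
      integral_const_mul] at key
    linarith
  · intro X hX
    have h3 := cauchy_pointwise (G₁ X) (G₂ X) (gradient η X) (u₂ X - u₁ X) δ (η X) M (hM X) (hδ X hX)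
    have h4 : (Metric.ball x r).indicator (fun X => ‖G₁ X - G₂ X‖ ^ 2) X ≤
        η X * ‖G₁ X - G₂ X‖ ^ 2 := by
      by_cases h : X ∈ Metric.ball x r
      · rw [Set.indicator_of_mem h, hηr X (Metric.ball_subset_closedBall h)]; simp
      · rw [Set.indicator_of_notMem h]
        exact mul_nonneg (hη0 X) (by positivity)
    simp only [Pi.add_apply]
    linarith

end Estimates

/-! ### Convergence in $L^2$ -/

section Convergence

variable {N : ℕ} {E : Type*} [NormedAddCommGroup E]

lemma eLpNorm_two_sq {α : Type*} [MeasurableSpace α] (μ : Measure α) (f : α → E) :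
    eLpNorm f 2 μ ^ 2 = ∫⁻ X, ‖f X‖ₑ ^ 2 ∂μ := by
  have := eLpNorm_nnreal_pow_eq_lintegral (f := f) (μ := μ) (p := 2) (by norm_num)
  simpa using this

lemma eLpNorm_two_union_le {α : Type*} [MeasurableSpace α] (μ : Measure α) (f : α → E)
    (s t : Set α) : eLpNorm f 2 (μ.restrict (s ∪ t)) ≤
      eLpNorm f 2 (μ.restrict s) + eLpNorm f 2 (μ.restrict t) := by
  rw [← ENNReal.pow_le_pow_left_iff (n := 2) (by norm_num), eLpNorm_two_sq]
  calc ∫⁻ X in s ∪ t, ‖f X‖ₑ ^ 2 ∂μ ≤ _ := lintegral_union_le _ _ _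
    _ = eLpNorm f 2 (μ.restrict s) ^ 2 + eLpNorm f 2 (μ.restrict t) ^ 2 := by
      rw [eLpNorm_two_sq, eLpNorm_two_sq]
    _ ≤ _ := by
      rw [add_sq]
      gcongr
      exact le_self_add

lemma toReal_eLpNorm_two_sq {D : Set (EuclideanSpace ℝ (Fin N))}
    {f : EuclideanSpace ℝ (Fin N) → E} (hf : MemLp f 2 (volume.restrict D)) :
    (eLpNorm f 2 (volume.restrict D)).toReal ^ 2 = ∫ X in D, ‖f X‖ ^ 2 := by
  rw [← ENNReal.toReal_pow, eLpNorm_two_sq, ofReal_integral_norm_sq hf,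
    ENNReal.toReal_ofReal (by positivity)]

/-- A sequence that is Cauchy in the mean of order two converges in the mean of order two. -/
lemma exists_limit_of_cauchy [CompleteSpace E] {D : Set (EuclideanSpace ℝ (Fin N))}
    {f : ℕ → EuclideanSpace ℝ (Fin N) → E} (hf : ∀ k, MemLp (f k) 2 (volume.restrict D))
    (hc : ∀ ε : ℝ, 0 < ε → ∃ m, ∀ j ≥ m, ∀ k ≥ m, ∫ X in D, ‖f j X - f k X‖ ^ 2 ≤ ε) :
    ∃ g, MemLp g 2 (volume.restrict D) ∧
      Tendsto (fun k => eLpNorm (f k - g) 2 (volume.restrict D)) atTop (𝓝 0) := by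
  have hcs : CauchySeq fun k => (hf k).toLp (f k) := by
    rw [Metric.cauchySeq_iff]
    intro ε hε
    obtain ⟨m, hm⟩ := hc (ε ^ 2 / 2) (by positivity)
    refine ⟨m, fun j hj k hk => ?_⟩
    have h1 := hm j hj k hk
    have h2 := toReal_eLpNorm_two_sq ((hf j).sub (hf k))
    simp only [Pi.sub_apply] at h2
    rw [dist_eq_norm, ← MemLp.toLp_sub, Lp.norm_toLp]
    refine lt_of_pow_lt_pow_left₀ 2 hε.le ?_
    rw [h2]
    nlinarith
  obtain ⟨g, hg⟩ := cauchySeq_tendsto_of_complete hcs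
  refine ⟨g, Lp.memLp g, ?_⟩
  rw [← Lp.tendsto_Lp_iff_tendsto_eLpNorm'' f hf g (Lp.memLp g)]
  simpa using hg

lemma ae_eq_of_tendsto_eLpNorm {α : Type*} [MeasurableSpace α] {μ : Measure α} {f : ℕ → α → E}
    {g h : α → E} (hf : ∀ k, MemLp (f k) 2 μ) (hg : MemLp g 2 μ) (hh : MemLp h 2 μ)
    (h1 : Tendsto (fun k => eLpNorm (f k - g) 2 μ) atTop (𝓝 0))
    (h2 : Tendsto (fun k => eLpNorm (f k - h) 2 μ) atTop (𝓝 0)) : g =ᵐ[μ] h := by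
  have h3 : eLpNorm (g - h) 2 μ = 0 := by
    refine le_antisymm (ge_of_tendsto' (x := atTop) (f := fun k => eLpNorm (f k - h) 2 μ +
      eLpNorm (f k - g) 2 μ) (by simpa using h2.add h1) fun k => ?_) bot_le
    have : g - h = (f k - h) - (f k - g) := by abel
    rw [this]
    exact eLpNorm_sub_le ((hf k).sub hh).1 ((hf k).sub hg).1 (by norm_num)
  rw [eLpNorm_eq_zero_iff (hg.sub hh).1 (by norm_num)] at h3
  filter_upwards [h3] with X hX using sub_eq_zero.1 hX

lemma tendsto_eLpNorm_of_tendsto {α : Type*} [MeasurableSpace α] {μ : Measure α} {f : ℕ → α → E}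
    {g : α → E} (hf : ∀ k, MemLp (f k) 2 μ) (hg : MemLp g 2 μ)
    (h1 : Tendsto (fun k => eLpNorm (f k - g) 2 μ) atTop (𝓝 0)) :
    Tendsto (fun k => eLpNorm (f k) 2 μ) atTop (𝓝 (eLpNorm g 2 μ)) := by
  have := ((Lp.tendsto_Lp_iff_tendsto_eLpNorm'' f hf g hg).2 h1).enorm
  simpa [Lp.enorm_toLp] using this

lemma tendsto_integral_norm_sq {D : Set (EuclideanSpace ℝ (Fin N))}
    {f : ℕ → EuclideanSpace ℝ (Fin N) → E} {g : EuclideanSpace ℝ (Fin N) → E}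
    (hf : ∀ k, MemLp (f k) 2 (volume.restrict D)) (hg : MemLp g 2 (volume.restrict D))
    (h1 : Tendsto (fun k => eLpNorm (f k - g) 2 (volume.restrict D)) atTop (𝓝 0)) :
    Tendsto (fun k => ∫ X in D, ‖f k X‖ ^ 2) atTop (𝓝 (∫ X in D, ‖g X‖ ^ 2)) := by
  simp only [← toReal_eLpNorm_two_sq (hf _), ← toReal_eLpNorm_two_sq hg]
  exact ((ENNReal.tendsto_toReal hg.2.ne).comp (tendsto_eLpNorm_of_tendsto hf hg h1)).pow 2

lemma tendsto_integral_of_tendsto_eLpNorm_two [NormedSpace ℝ E] {α : Type*} [MeasurableSpace α]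
    {μ : Measure α} [IsFiniteMeasure μ] {f : ℕ → α → E}
    {g : α → E} (hf : ∀ k, MemLp (f k) 2 μ) (hg : MemLp g 2 μ)
    (h1 : Tendsto (fun k => eLpNorm (f k - g) 2 μ) atTop (𝓝 0)) :
    Tendsto (fun k => ∫ X, f k X ∂μ) atTop (𝓝 (∫ X, g X ∂μ)) := by
  refine tendsto_integral_of_L1' g hg.1
    (Eventually.of_forall fun k => (hf k).integrable (by norm_num)) ?_
  have hC : μ Set.univ ^ (1 / (1 : ℝ≥0∞).toReal - 1 / (2 : ℝ≥0∞).toReal) ≠ ⊤ :=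
    ENNReal.rpow_ne_top_of_nonneg (by norm_num) (measure_ne_top _ _)
  refine tendsto_of_tendsto_of_tendsto_of_le_of_le tendsto_const_nhds
    (by simpa using ENNReal.Tendsto.mul_const h1 (Or.inr hC)) (fun _ => bot_le) fun k => ?_
  simpa using eLpNorm_le_eLpNorm_mul_rpow_measure_univ (p := 1) (q := 2) (by norm_num)
    ((hf k).sub hg).1

lemma tendsto_eLpNorm_of_norm_le {E' : Type*} [NormedAddCommGroup E'] {α : Type*}
    [MeasurableSpace α] {μ : Measure α} {f : ℕ → α → E} {g : ℕ → α → E'} (C : ℝ)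
    (h1 : Tendsto (fun k => eLpNorm (f k) 2 μ) atTop (𝓝 0))
    (h : ∀ k, ∀ᵐ X ∂μ, ‖g k X‖ ≤ C * ‖f k X‖) :
    Tendsto (fun k => eLpNorm (g k) 2 μ) atTop (𝓝 0) := by
  refine tendsto_of_tendsto_of_tendsto_of_le_of_le tendsto_const_nhds
    (by simpa using ENNReal.Tendsto.const_mul (a := ENNReal.ofReal C) h1 (Or.inr (by simp)))
    (fun _ => bot_le) fun k => ?_
  exact eLpNorm_le_mul_eLpNorm_of_ae_le_mul (h k) 2

lemma tendsto_eLpNorm_of_uniform {K : Set (EuclideanSpace ℝ (Fin N))} (hK : IsCompact K)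
    {f : ℕ → EuclideanSpace ℝ (Fin N) → ℝ} {g : EuclideanSpace ℝ (Fin N) → ℝ}
    (h : TendstoUniformlyOn f g atTop K) :
    Tendsto (fun k => eLpNorm (f k - g) 2 (volume.restrict K)) atTop (𝓝 0) := by
  have hm : (volume.restrict K) Set.univ ^ ((2 : ℝ≥0∞).toReal⁻¹) ≠ ⊤ :=
    ENNReal.rpow_ne_top_of_nonneg (by norm_num) (by simpa using hK.measure_lt_top.ne)
  set m := (volume.restrict K) Set.univ ^ ((2 : ℝ≥0∞).toReal⁻¹) with hmdef
  have ht : Tendsto (fun ε : ℝ => m * ENNReal.ofReal ε) (𝓝[>] 0) (𝓝 0) := by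
    have : Tendsto (fun ε : ℝ => m * ENNReal.ofReal ε) (𝓝 0) (𝓝 (m * ENNReal.ofReal 0)) :=
      ENNReal.Tendsto.const_mul (ENNReal.tendsto_ofReal tendsto_id) (Or.inr hm)
    simpa using this.mono_left nhdsWithin_le_nhds
  rw [ENNReal.tendsto_nhds_zero]
  intro δ hδ
  obtain ⟨ε, hε, hε0⟩ := ((ENNReal.tendsto_nhds_zero.1 ht δ hδ).and self_mem_nhdsWithin).exists
  filter_upwards [Metric.tendstoUniformlyOn_iff.1 h ε hε0] with k hk
  refine le_trans (eLpNorm_le_of_ae_bound (C := ε) ?_) hε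
  filter_upwards [ae_restrict_mem hK.measurableSet] with X hX
  have := hk X hX
  rw [dist_comm, dist_eq_norm] at this
  exact this.le

lemma memLp_of_tendsto_eLpNorm {α : Type*} [MeasurableSpace α] {μ : Measure α} {f : ℕ → α → E}
    {g : α → E} (hf : ∀ k, MemLp (f k) 2 μ) (hg : AEStronglyMeasurable g μ)
    (h1 : Tendsto (fun k => eLpNorm (f k - g) 2 μ) atTop (𝓝 0)) : MemLp g 2 μ := by
  obtain ⟨k, hk⟩ := ((ENNReal.tendsto_nhds_zero.1 h1 1 (by norm_num))).exists
  have h2 : MemLp (f k - g) 2 μ := ⟨(hf k).1.sub hg, hk.trans_lt (by simp)⟩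
  simpa using (hf k).sub h2

end Convergence

/-! ### Strong convergence of the gradients -/

section LimitGradient

variable {n : ℕ} {Ω K : Set (EuclideanSpace ℝ (Fin (n + 1)))}
  {u : ℕ → EuclideanSpace ℝ (Fin (n + 1)) → ℝ} {uLim : EuclideanSpace ℝ (Fin (n + 1)) → ℝ}
  {G : ℕ → EuclideanSpace ℝ (Fin (n + 1)) → EuclideanSpace ℝ (Fin (n + 1))}

lemma memLp_limit (hG : ∀ k, IsH1 Ω (u k) (G k)) (hΩ : IsOpen Ω)
    (hconv : TendstoLocallyUniformlyOn u uLim atTop Ω) (hK : IsCompact K) (hKΩ : K ⊆ Ω) :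
    MemLp uLim 2 (volume.restrict K) ∧
      Tendsto (fun k => eLpNorm (u k - uLim) 2 (volume.restrict K)) atTop (𝓝 0) := by
  have hunif := (tendstoLocallyUniformlyOn_iff_forall_isCompact hΩ).1 hconv K hKΩ hK
  have h1 := tendsto_eLpNorm_of_uniform hK hunif
  refine ⟨memLp_of_tendsto_eLpNorm (fun k => ((hG k).2 K hK hKΩ).1) ?_ h1, h1⟩
  refine aestronglyMeasurable_of_tendsto_ae atTop (fun k => ((hG k).2 K hK hKΩ).1.1) ?_
  filter_upwards [ae_restrict_mem hK.measurableSet] with X hX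
  exact hunif.tendsto_at hX

/-- On balls, the gradients of a convergent sequence of minimizers converge. -/
lemma exists_gradient_limit_ball (hΩ : IsOpen Ω) (hu : ∀ k, IsMinimizer Ω (u k))
    (hG : ∀ k, IsH1 Ω (u k) (G k)) (hconv : TendstoLocallyUniformlyOn u uLim atTop Ω)
    {x : EuclideanSpace ℝ (Fin (n + 1))} {r R : ℝ} (hr : 0 < r) (hrR : r < R)
    (hR : Metric.closedBall x R ⊆ Ω) :
    ∃ g, MemLp g 2 (volume.restrict (Metric.ball x r)) ∧
      Tendsto (fun k => eLpNorm (G k - g) 2 (volume.restrict (Metric.ball x r))) atTop (𝓝 0) := by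
  -- Two shrinkings are needed: Caccioppoli from `R` to `s` bounds the gradients uniformly in `k`,
  -- and the Cauchy estimate from `s` to `r` uses that bound.
  obtain ⟨s, hrs, hsR⟩ := exists_between hrR
  have hs := hr.trans hrs
  have hsΩ : Metric.closedBall x s ⊆ Ω := (Metric.closedBall_subset_closedBall hsR.le).trans hR
  have hrΩ : Metric.closedBall x r ⊆ Ω := (Metric.closedBall_subset_closedBall hrR.le).trans hR
  have hDr := isSubdomain_ball hr hrΩ
  have hDs := isSubdomain_ball hs hsΩ
  have hunif := (tendstoLocallyUniformlyOn_iff_forall_isCompact hΩ).1 hconv _ hR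
    (isCompact_closedBall x R)
  obtain ⟨C₁, hC₁, hcac⟩ := exists_caccioppoli x hs hsR hΩ hR
  obtain ⟨C₂, hC₂, hcau⟩ := exists_cauchy_estimate x hr hrs hΩ hsΩ
  have hbd : ∃ B, ∀ k, ∫ X in Metric.ball x R, u k X ^ 2 ≤ B := by
    have h1 := memLp_limit hG hΩ hconv (isCompact_closedBall x R) hR
    have h2 := tendsto_integral_norm_sq
      (fun k => ((hG k).2 _ (isCompact_closedBall x R) hR).1) h1.1 h1.2
    obtain ⟨B, hB⟩ := h2.bddAbove_range
    refine ⟨B, fun k => le_trans ?_ (hB (Set.mem_range_self k))⟩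
    simp only [Real.norm_eq_abs, sq_abs]
    exact setIntegral_mono_set ((hG k).2 _ (isCompact_closedBall x R) hR).1.integrable_sq
      (Eventually.of_forall fun X => by positivity) Metric.ball_subset_closedBall.eventuallyLE
  obtain ⟨B, hB⟩ := hbd
  have hGB : ∀ k, ∫ X in Metric.ball x s, ‖G k X‖ ^ 2 ≤ C₁ * B := fun k =>
    (hcac _ _ (hu k) (hG k)).trans (mul_le_mul_of_nonneg_left (hB k) hC₁)
  have : IsFiniteMeasure (volume.restrict (Metric.ball x s)) :=
    ⟨by simpa using measure_ball_lt_top⟩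
  set A := (∫ X in Metric.ball x s, (2 : ℝ)) + C₁ * B + C₁ * B with hA
  have hsum : ∀ j k, ∫ X in Metric.ball x s, (2 + ‖G j X‖ ^ 2 + ‖G k X‖ ^ 2) ≤ A := by
    intro j k
    have mj := ((hG j).memLp hDs).2.norm.integrable_sq
    have mk := ((hG k).memLp hDs).2.norm.integrable_sq
    have m2 : Integrable (fun X => 2 + ‖G j X‖ ^ 2) (volume.restrict (Metric.ball x s)) :=
      (integrable_const 2).add mj
    rw [integral_add m2 mk, integral_add (integrable_const 2) mj]
    linarith [hGB j, hGB k]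
  have hA0 : 0 ≤ A := (integral_nonneg fun X => by positivity).trans (hsum 0 0)
  refine exists_limit_of_cauchy (fun k => ((hG k).memLp hDr).2) fun ε hε => ?_
  have hB1 : 0 < C₂ * A + 1 := by positivity
  -- The Cauchy estimate gives at most `δ * (C₂ * A)`, so $\delta=\varepsilon/(C_2A+1)$ suffices;
  -- the `+ 1` keeps the denominator positive.
  obtain ⟨m, hm⟩ := Metric.uniformCauchySeqOn_iff.1 hunif.uniformCauchySeqOn
    (ε / (C₂ * A + 1)) (by positivity)
  refine ⟨m, fun j hj k hk => ?_⟩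
  refine (hcau (u j) (u k) (G j) (G k) (ε / (C₂ * A + 1)) (hu j) (hu k) (hG j) (hG k) ?_).trans ?_
  · intro X hX
    have := hm k hk j hj X (Metric.ball_subset_closedBall (Metric.ball_subset_ball hsR.le hX))
    rw [Real.dist_eq] at this
    exact this.le
  · rw [div_mul_eq_mul_div, div_le_iff₀ hB1]
    have := mul_le_mul_of_nonneg_left (hsum j k) hC₂
    nlinarith

/-- The gradients of a convergent sequence of minimizers converge locally in `L²`, and their limit
is the weak gradient of the limit function. -/
theorem exists_gradient_limit (hΩ : IsOpen Ω) (hu : ∀ k, IsMinimizer Ω (u k))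
    (hG : ∀ k, IsH1 Ω (u k) (G k)) (hconv : TendstoLocallyUniformlyOn u uLim atTop Ω) :
    ∃ g, IsH1 Ω uLim g ∧ ∀ K : Set (EuclideanSpace ℝ (Fin (n + 1))), IsCompact K → K ⊆ Ω →
      Tendsto (fun k => eLpNorm (G k - g) 2 (volume.restrict K)) atTop (𝓝 0) := by
  have hex : ∀ x : EuclideanSpace ℝ (Fin (n + 1)), ∃ r : ℝ, ∃ g, x ∈ Ω → 0 < r ∧
      Metric.closedBall x r ⊆ Ω ∧ MemLp g 2 (volume.restrict (Metric.ball x r)) ∧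
      Tendsto (fun k => eLpNorm (G k - g) 2 (volume.restrict (Metric.ball x r))) atTop (𝓝 0) := by
    intro x
    by_cases hx : x ∈ Ω
    · obtain ⟨R, hR, hRΩ⟩ := Metric.nhds_basis_closedBall.mem_iff.1 (hΩ.mem_nhds hx)
      obtain ⟨g, hg⟩ := exists_gradient_limit_ball hΩ hu hG hconv (half_pos hR)
        (half_lt_self hR) hRΩ
      exact ⟨R / 2, g, fun _ => ⟨half_pos hR,
        (Metric.closedBall_subset_closedBall (half_le_self hR.le)).trans hRΩ, hg⟩⟩
    · exact ⟨0, 0, fun h => absurd h hx⟩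
  choose r g hrg using hex
  -- A countable subcover makes the local limits compatible on all overlaps outside one null set.
  obtain ⟨t, htΩ, htc, hcov⟩ := TopologicalSpace.countable_cover_nhdsWithin
    (s := Ω) (f := fun x => Metric.ball x (r x))
    fun x hx => mem_nhdsWithin_of_mem_nhds (Metric.ball_mem_nhds x (hrg x hx).1)
  have hidx : ∀ X : EuclideanSpace ℝ (Fin (n + 1)), ∃ i, X ∈ Ω → i ∈ t ∧ X ∈ Metric.ball i (r i) := by
    intro X
    by_cases hX : X ∈ Ω
    · obtain ⟨i, hi, hXi⟩ := Set.mem_iUnion₂.1 (hcov hX)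
      exact ⟨i, fun _ => ⟨hi, hXi⟩⟩
    · exact ⟨0, fun h => absurd h hX⟩
  choose idx hidx using hidx
  have hGb : ∀ x ∈ t, ∀ k, MemLp (G k) 2 (volume.restrict (Metric.ball x (r x))) := fun x hx k =>
    ((hG k).memLp (isSubdomain_ball (hrg x (htΩ hx)).1 (hrg x (htΩ hx)).2.1)).2
  have hcompat : ∀ᵐ X, ∀ i ∈ t, ∀ j ∈ t, X ∈ Metric.ball i (r i) → X ∈ Metric.ball j (r j) →
      g i X = g j X := by
    refine (ae_ball_iff htc).2 fun i hi => (ae_ball_iff htc).2 fun j hj => ?_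
    have key : g i =ᵐ[volume.restrict (Metric.ball i (r i) ∩ Metric.ball j (r j))] g j := by
      have le1 : volume.restrict (Metric.ball i (r i) ∩ Metric.ball j (r j)) ≤
        volume.restrict (Metric.ball i (r i)) := Measure.restrict_mono Set.inter_subset_left le_rfl
      have le2 : volume.restrict (Metric.ball i (r i) ∩ Metric.ball j (r j)) ≤
        volume.restrict (Metric.ball j (r j)) := Measure.restrict_mono Set.inter_subset_right le_rfl
      obtain ⟨-, -, m1, t1⟩ := hrg i (htΩ hi)
      obtain ⟨-, -, m2, t2⟩ := hrg j (htΩ hj)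
      refine ae_eq_of_tendsto_eLpNorm (f := G) (fun k => (hGb i hi k).mono_measure le1)
        (m1.mono_measure le1) (m2.mono_measure le2) ?_ ?_
      · exact tendsto_of_tendsto_of_tendsto_of_le_of_le tendsto_const_nhds t1 (fun _ => bot_le)
          fun k => eLpNorm_mono_measure _ le1
      · exact tendsto_of_tendsto_of_tendsto_of_le_of_le tendsto_const_nhds t2 (fun _ => bot_le)
          fun k => eLpNorm_mono_measure _ le2
    rw [EventuallyEq, ae_restrict_iff'
      (Metric.isOpen_ball.inter Metric.isOpen_ball).measurableSet] at key
    filter_upwards [key] with X hX h1 h2 using hX ⟨h1, h2⟩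
  -- The index is an arbitrary choice of covering ball. It need not be measurable in `X`, since on
  -- each ball the glued function agrees almost everywhere with the local limit.
  let g' : EuclideanSpace ℝ (Fin (n + 1)) → EuclideanSpace ℝ (Fin (n + 1)) :=
    fun X => g (idx X) X
  have hg' : ∀ i ∈ t, g' =ᵐ[volume.restrict (Metric.ball i (r i))] g i := by
    intro i hi
    rw [EventuallyEq, ae_restrict_iff' Metric.isOpen_ball.measurableSet]
    filter_upwards [hcompat] with X hX hXi
    have hXΩ : X ∈ Ω := (hrg i (htΩ hi)).2.1 (Metric.ball_subset_closedBall hXi)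
    exact hX _ (hidx X hXΩ).1 i hi (hidx X hXΩ).2 hXi
  have hloc : ∀ K : Set (EuclideanSpace ℝ (Fin (n + 1))), IsCompact K → K ⊆ Ω →
      AEStronglyMeasurable g' (volume.restrict K) ∧
      Tendsto (fun k => eLpNorm (G k - g') 2 (volume.restrict K)) atTop (𝓝 0) := by
    intro K hK hKΩ
    refine hK.induction_on (p := fun K => AEStronglyMeasurable g' (volume.restrict K) ∧
      Tendsto (fun k => eLpNorm (G k - g') 2 (volume.restrict K)) atTop (𝓝 0)) ?_ ?_ ?_ ?_
    · simp
    · intro s t hst h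
      refine ⟨h.1.mono_measure (Measure.restrict_mono hst le_rfl), ?_⟩
      exact tendsto_of_tendsto_of_tendsto_of_le_of_le tendsto_const_nhds h.2 (fun _ => bot_le)
        fun k => eLpNorm_mono_measure _ (Measure.restrict_mono hst le_rfl)
    · intro s t hs ht
      refine ⟨aestronglyMeasurable_union_iff.2 ⟨hs.1, ht.1⟩, ?_⟩
      exact tendsto_of_tendsto_of_tendsto_of_le_of_le tendsto_const_nhds
        (by simpa using hs.2.add ht.2) (fun _ => bot_le) fun k => eLpNorm_two_union_le _ _ _ _
    · intro X hX
      obtain ⟨i, hi, hXi⟩ := Set.mem_iUnion₂.1 (hcov (hKΩ hX))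
      refine ⟨Metric.ball i (r i), mem_nhdsWithin_of_mem_nhds (Metric.isOpen_ball.mem_nhds hXi), ?_⟩
      obtain ⟨-, -, m1, t1⟩ := hrg i (htΩ hi)
      refine ⟨m1.1.congr (hg' i hi).symm, t1.congr fun k => eLpNorm_congr_ae ?_⟩
      filter_upwards [hg' i hi] with X hX
      simp [hX]
  have hmem : ∀ K : Set (EuclideanSpace ℝ (Fin (n + 1))), IsCompact K → K ⊆ Ω →
      MemLp g' 2 (volume.restrict K) := fun K hK hKΩ =>
    memLp_of_tendsto_eLpNorm (fun k => ((hG k).2 K hK hKΩ).2) (hloc K hK hKΩ).1 (hloc K hK hKΩ).2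
  refine ⟨g', IsH1.of_integral hΩ (fun K hK hKΩ =>
    ⟨(memLp_limit hG hΩ hconv hK hKΩ).1, hmem K hK hKΩ⟩) ?_, fun K hK hKΩ => (hloc K hK hKΩ).2⟩
  intro φ hφ e
  have hK : IsCompact (tsupport φ) := hφ.2.1
  have hfin : IsFiniteMeasure (volume.restrict (tsupport φ)) :=
    ⟨by simpa using hK.measure_lt_top⟩
  have hcf : Continuous fun X => fderiv ℝ φ X e :=
    (hφ.1.continuous_fderiv (by simp)).clm_apply continuous_const
  have s1 : ∀ v : EuclideanSpace ℝ (Fin (n + 1)) → ℝ,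
      ∫ X, v X * fderiv ℝ φ X e = ∫ X in tsupport φ, fderiv ℝ φ X e • v X := fun v => by
    rw [setIntegral_eq_integral_of_forall_compl_eq_zero fun X hX => by
      rw [fderiv_zero_of_notMem_tsupport hX]; simp]
    simp only [smul_eq_mul, mul_comm]
  have s2 : ∀ H : EuclideanSpace ℝ (Fin (n + 1)) → EuclideanSpace ℝ (Fin (n + 1)),
      LocallyIntegrableOn H Ω volume →
      ∫ X, φ X * inner ℝ (H X) e = inner ℝ e (∫ X in tsupport φ, φ X • H X) := fun H hH => by
    rw [setIntegral_eq_integral_of_forall_compl_eq_zero fun X hX => by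
      rw [image_eq_zero_of_notMem_tsupport hX, zero_smul], ← integral_inner (hφ.integrable_smul hH)]
    simp only [inner_smul_right, real_inner_comm]
  have mU := memLp_limit hG hΩ hconv hK hφ.2.2
  have t1 : Tendsto (fun k => ∫ X in tsupport φ, fderiv ℝ φ X e • u k X) atTop
      (𝓝 (∫ X in tsupport φ, fderiv ℝ φ X e • uLim X)) := by
    obtain ⟨C, hC⟩ := hK.exists_bound_of_continuousOn hcf.continuousOn
    refine tendsto_integral_of_tendsto_eLpNorm_two
      (fun k => memLp_smul_of_continuous hK hcf ((hG k).2 _ hK hφ.2.2).1)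
      (memLp_smul_of_continuous hK hcf mU.1) (tendsto_eLpNorm_of_norm_le C mU.2 fun k => ?_)
    filter_upwards [ae_restrict_mem hK.measurableSet] with X hX
    simp only [Pi.sub_apply, ← smul_sub, norm_smul]
    exact mul_le_mul_of_nonneg_right (hC X hX) (norm_nonneg _)
  have t2 : Tendsto (fun k => ∫ X in tsupport φ, φ X • G k X) atTop
      (𝓝 (∫ X in tsupport φ, φ X • g' X)) := by
    obtain ⟨C, hC⟩ := hK.exists_bound_of_continuousOn hφ.continuous.continuousOn
    refine tendsto_integral_of_tendsto_eLpNorm_two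
      (fun k => memLp_smul_of_continuous hK hφ.continuous ((hG k).2 _ hK hφ.2.2).2)
      (memLp_smul_of_continuous hK hφ.continuous (hmem _ hK hφ.2.2))
      (tendsto_eLpNorm_of_norm_le C (hloc _ hK hφ.2.2).2 fun k => ?_)
    filter_upwards [ae_restrict_mem hK.measurableSet] with X hX
    simp only [Pi.sub_apply, ← smul_sub, norm_smul]
    exact mul_le_mul_of_nonneg_right (hC X hX) (norm_nonneg _)
  rw [s1, s2 g' (locallyIntegrableOn_of_memLp hΩ hmem)]
  have t3 : Tendsto (fun k => inner ℝ e (∫ X in tsupport φ, φ X • G k X)) atTop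
      (𝓝 (inner ℝ e (∫ X in tsupport φ, φ X • g' X))) := tendsto_const_nhds.inner t2
  -- Both sides of the integration by parts formula for `u k` converge, so the formula holds for the
  -- limit.
  refine tendsto_nhds_unique t1 (t3.neg.congr fun k => ?_)
  rw [← s1, ← s2 _ (hG k).1.2.1, (hG k).1.integral_eq hφ]

end LimitGradient

/-! ### Minimality of the limit -/

section LimitMinimality

variable {n N : ℕ}

/-- The cutoff equals one on an open neighborhood of `K`, not just on `K`, because comparing precise
values requires equality on open sets. -/
lemma exists_compact_cutoff {K D : Set (EuclideanSpace ℝ (Fin N))} (hK : IsCompact K)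
    (hD : IsOpen D) (hKD : K ⊆ D) : ∃ (φ : EuclideanSpace ℝ (Fin N) → ℝ) (V : Set _),
      IsTest D φ ∧ IsOpen V ∧ K ⊆ V ∧ (∀ X ∈ V, φ X = 1) ∧ (∀ X, 0 ≤ φ X) ∧ ∀ X, φ X ≤ 1 := by
  obtain ⟨T, hT, hKT, hTD⟩ := exists_compact_between hK hD hKD
  obtain ⟨f, h1, h0, h01⟩ := exists_contMDiffMap_one_nhds_of_subset_interior (n := ⊤)
    (modelWithCornersSelf ℝ (EuclideanSpace ℝ (Fin N))) hK.isClosed hKT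
  obtain ⟨V, hV, hKV, hV1⟩ := mem_nhdsSet_iff_exists.1 h1
  have hs : tsupport f ⊆ T := closure_minimal
    (fun X hX => by by_contra h; exact hX (h0 X h)) hT.isClosed
  exact ⟨f, V, ⟨f.contMDiff.contDiff, hT.of_isClosed_subset (isClosed_tsupport _) hs,
    hs.trans hTD⟩, hV, hKV, hV1, fun X => (h01 X).1, fun X => (h01 X).2⟩

variable {Ω D : Set (EuclideanSpace ℝ (Fin (n + 1)))}

/-- Precise values are inherited by locally uniform limits. -/
lemma hasPreciseValue_of_tendsto {Ω : Set (EuclideanSpace ℝ (Fin N))}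
    {u : ℕ → EuclideanSpace ℝ (Fin N) → ℝ} {uLim : EuclideanSpace ℝ (Fin N) → ℝ}
    (hΩ : IsOpen Ω) (hconv : TendstoLocallyUniformlyOn u uLim atTop Ω)
    (hu : ∀ k, LocallyIntegrableOn (u k) Ω volume) (hl : LocallyIntegrableOn uLim Ω volume)
    {X : EuclideanSpace ℝ (Fin N)} (hX : X ∈ Ω) (hp : ∀ k, HasPreciseValue (u k) X (u k X)) :
    HasPreciseValue uLim X (uLim X) := by
  obtain ⟨R, hR, hRΩ⟩ := Metric.nhds_basis_closedBall.mem_iff.1 (hΩ.mem_nhds hX)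
  have hunif := (tendstoLocallyUniformlyOn_iff_forall_isCompact hΩ).1 hconv _ hRΩ
    (isCompact_closedBall X R)
  rw [HasPreciseValue, Metric.tendsto_nhds]
  intro ε hε
  obtain ⟨k, hk⟩ := (Metric.tendstoUniformlyOn_iff.1 hunif (ε / 3) (by positivity)).exists
  filter_upwards [Metric.tendsto_nhds.1 (hp k) (ε / 3) (by positivity), Ioo_mem_nhdsGT hR]
    with r hr hr0
  have hrR : Metric.closedBall X r ⊆ Metric.closedBall X R :=
    Metric.closedBall_subset_closedBall hr0.2.le
  have h1 : |(⨍ Y in Metric.ball X r, uLim Y) - ⨍ Y in Metric.ball X r, u k Y| ≤ ε / 3 := by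
    rw [setAverage_eq, setAverage_eq, ← smul_sub, ← integral_sub
      (integrableOn_ball hl (hrR.trans hRΩ)) (integrableOn_ball (hu k) (hrR.trans hRΩ)),
      smul_eq_mul, abs_mul]
    have h2 : ‖∫ Y in Metric.ball X r, (uLim Y - u k Y)‖ ≤
        ε / 3 * volume.real (Metric.ball X r) := by
      refine norm_setIntegral_le_of_norm_le_const measure_ball_lt_top fun Y hY => ?_
      have := hk Y (hrR (Metric.ball_subset_closedBall hY))
      rw [dist_eq_norm] at this
      exact this.le
    have h3 : 0 < volume.real (Metric.ball X r) := by
      rw [measureReal_def]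
      exact ENNReal.toReal_pos (Metric.measure_ball_pos _ _ hr0.1).ne' measure_ball_lt_top.ne
    rw [abs_of_pos (inv_pos.2 h3), inv_mul_le_iff₀ h3, mul_comm]
    exact h2
  have h4 := hk X (Metric.mem_closedBall_self hR.le)
  rw [Real.dist_eq] at hr h4 ⊢
  have h5 := abs_le.1 h1
  have h6 := abs_lt.1 hr
  have h7 := abs_lt.1 h4
  rw [abs_lt]
  constructor <;> linarith [h5.1, h5.2, h6.1, h6.2, h7.1, h7.2]

/-- A function given by its precise values is Borel measurable. -/
lemma measurable_indicator_of_precise {Ω : Set (EuclideanSpace ℝ (Fin N))}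
    {u : EuclideanSpace ℝ (Fin N) → ℝ} (hΩ : IsOpen Ω) (hu : LocallyIntegrableOn u Ω volume)
    (hp : ∀ X ∈ Ω, HasPreciseValue u X (u X)) : Measurable (Ω.indicator u) := by
  have hm := hu.aestronglyMeasurable
  -- For a measurable representative, the average over a ball of fixed radius is measurable in the
  -- center by Fubini. The precise value is the limit of these averages along the radii $1/(m+1)$.
  set w := hm.mk u with hw
  have hwm : StronglyMeasurable w := hm.stronglyMeasurable_mk
  have huw : ∀ᵐ Y ∂volume, Y ∈ Ω → w Y = u Y := by
    have := hm.ae_eq_mk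
    rw [EventuallyEq, ae_restrict_iff' hΩ.measurableSet] at this
    filter_upwards [this] with Y hY hYΩ using (hY hYΩ).symm
  have hmeas : ∀ r : ℝ, Measurable fun X => ⨍ Y in Metric.ball X r, w Y := by
    intro r
    simp only [setAverage_eq, Measure.addHaar_real_ball_center volume _ r, smul_eq_mul]
    refine Measurable.const_mul ?_ _
    have hset : MeasurableSet {p : EuclideanSpace ℝ (Fin N) × EuclideanSpace ℝ (Fin N) |
        dist p.2 p.1 < r} := measurableSet_lt (measurable_snd.dist measurable_fst) measurable_const
    have h1 : StronglyMeasurable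
        ({p : EuclideanSpace ℝ (Fin N) × EuclideanSpace ℝ (Fin N) | dist p.2 p.1 < r}.indicator
          fun p => w p.2) := (hwm.comp_measurable measurable_snd).indicator hset
    have h2 := (h1.integral_prod_right' (ν := volume)).measurable
    convert h2 using 2 with X
    rw [← integral_indicator Metric.isOpen_ball.measurableSet]
    rfl
  refine measurable_of_tendsto_metrizable (f := fun m : ℕ => Ω.indicator fun X =>
    ⨍ Y in Metric.ball X (1 / ((m : ℝ) + 1)), w Y)
    (fun m => (hmeas _).indicator hΩ.measurableSet) ?_
  rw [tendsto_pi_nhds]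
  intro X
  by_cases hX : X ∈ Ω
  · simp only [Set.indicator_of_mem hX]
    have h1 : HasPreciseValue w X (u X) := (hasPreciseValue_congr hΩ hX huw).2 (hp X hX)
    refine Tendsto.comp h1 (tendsto_nhdsWithin_iff.2
      ⟨tendsto_one_div_add_atTop_nhds_zero_nat, Eventually.of_forall fun m => ?_⟩)
    simp only [Set.mem_Ioi]; positivity
  · simp only [Set.indicator_of_notMem hX]
    exact tendsto_const_nhds

/-- Measurability modulo null sets of $\mathbb R^{n+1}$ says nothing on the hyperplane, so the Borel
measurability supplied by precise values is used. -/
lemma measurableSet_thin_pos {u : EuclideanSpace ℝ (Fin (n + 1)) → ℝ}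
    (h : ∀ X ∈ Ω, HasPreciseValue u X (u X)) (hu : LocallyIntegrableOn u Ω volume)
    (hΩ : IsOpen Ω) (hD : IsOpen D) (hDΩ : D ⊆ Ω) :
    MeasurableSet {x | thin x ∈ D ∧ 0 < u (thin x)} := by
  have h1 := (measurable_indicator_of_precise hΩ hu h).comp continuous_thin.measurable
  have h2 : {x | thin x ∈ D ∧ 0 < u (thin x)} =
      thin ⁻¹' D ∩ (Ω.indicator u ∘ thin) ⁻¹' Set.Ioi 0 := by
    ext x
    refine and_congr_right fun hx => ?_
    simp [Set.indicator_of_mem (hDΩ hx)]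
  rw [h2]
  exact (hD.preimage continuous_thin).measurableSet.inter (h1 measurableSet_Ioi)

variable {u : ℕ → EuclideanSpace ℝ (Fin (n + 1)) → ℝ} {uLim : EuclideanSpace ℝ (Fin (n + 1)) → ℝ}
  {G : ℕ → EuclideanSpace ℝ (Fin (n + 1)) → EuclideanSpace ℝ (Fin (n + 1))}
  {g : EuclideanSpace ℝ (Fin (n + 1)) → EuclideanSpace ℝ (Fin (n + 1))}

/-- The positivity set of the limit is asymptotically contained in those of the sequence. -/
lemma tendsto_measure_diff (hΩ : IsOpen Ω) (hD : IsSubdomain Ω D)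
    (hu : ∀ k, IsMinimizer Ω (u k)) (hG : ∀ k, IsH1 Ω (u k) (G k)) (hg : IsH1 Ω uLim g)
    (hp : ∀ X ∈ Ω, HasPreciseValue uLim X (uLim X))
    (hconv : TendstoLocallyUniformlyOn u uLim atTop Ω) :
    Tendsto (fun k => volume.real ({x | thin x ∈ D ∧ 0 < uLim (thin x)} \
      {x | thin x ∈ D ∧ 0 < u k (thin x)})) atTop (𝓝 0) := by
  have hm := measurableSet_thin_pos hp hg.1.1 hΩ hD.isOpen hD.self_subset
  -- Pointwise convergence makes every point leave these sets eventually. They all lie in the slice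
  -- of `D`, which has finite measure, so their measures tend to zero.
  have h1 := tendsto_measure_of_tendsto_indicator (L := atTop) (μ := volume) (A := ∅)
    (As := fun k => {x | thin x ∈ D ∧ 0 < uLim (thin x)} \ {x | thin x ∈ D ∧ 0 < u k (thin x)})
    (fun k => hm.diff (measurableSet_thin_pos (hu k).precise (hG k).1.1 hΩ hD.isOpen
      hD.self_subset)) (B := thin ⁻¹' D) (hD.isOpen.preimage continuous_thin).measurableSet
    (volume_slice_lt_top hD.isBounded).ne (Eventually.of_forall fun k x hx => hx.1.1) ?_
  · have := (ENNReal.tendsto_toReal (by simp)).comp h1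
    rw [measure_empty, ENNReal.toReal_zero] at this
    exact this
  · intro x
    by_cases hx : thin x ∈ D ∧ 0 < uLim (thin x)
    · have ht := hconv.tendsto_at (hD.self_subset hx.1)
      filter_upwards [ht.eventually (lt_mem_nhds hx.2)] with k hk
      exact ⟨fun h => h.2 ⟨h.1.1, hk⟩, fun h => h.elim⟩
    · exact Eventually.of_forall fun k => by simp [hx]

/-- A locally uniform limit of minimizers is a local minimizer. -/
theorem isLocalMinimizer_of_tendsto (hΩ : IsOpen Ω)
    (hu : ∀ k, IsMinimizer Ω (u k)) (hG : ∀ k, IsH1 Ω (u k) (G k)) (hg : IsH1 Ω uLim g)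
    (hp : ∀ X ∈ Ω, HasPreciseValue uLim X (uLim X)) (h0 : ∀ X ∈ Ω, 0 ≤ uLim X)
    (hconv : TendstoLocallyUniformlyOn u uLim atTop Ω)
    (hGg : ∀ K : Set (EuclideanSpace ℝ (Fin (n + 1))), IsCompact K → K ⊆ Ω →
      Tendsto (fun k => eLpNorm (G k - g) 2 (volume.restrict K)) atTop (𝓝 0)) :
    IsLocalMinimizer Ω uLim := by
  refine ⟨⟨g, hg⟩, fun D hD1 hD2 hD3 hD4 v ⟨Gv, hv⟩ ⟨U, hU, hDU, hvU⟩ => ?_⟩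
  replace hv : IsH1 Ω v Gv := hv
  have hD : IsSubdomain Ω D := ⟨hD1, hD2, hD3, hD4⟩
  have hDΩ := hD.self_subset
  -- `K₀` is a compact subset of `D` off which `v` and `uLim` agree almost everywhere in `Ω`.
  set K₀ := closure D \ U with hK₀
  have hK₀c : IsCompact K₀ := hD3.diff hU
  have hK₀D : K₀ ⊆ D := fun X hX => by
    by_contra h
    exact hX.2 (hDU ⟨hD4 hX.1, h⟩)
  have hveq : ∀ᵐ X ∂volume, X ∈ Ω \ K₀ → v X = uLim X := by
    filter_upwards [hvU] with X hX hX'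
    refine hX ⟨hX'.1, ?_⟩
    by_contra h
    exact hX'.2 ⟨by_contra fun h' => h (hDU ⟨hX'.1, fun h'' => h' (subset_closure h'')⟩), h⟩
  have hWo : IsOpen (Ω \ K₀) := hΩ.sdiff hK₀c.isClosed
  obtain ⟨φ, V, hφ, hV, hKV, hV1, hφ0, hφ1⟩ := exists_compact_cutoff hK₀c hD1 hK₀D
  have hφ' : ContDiff ℝ ∞ fun X => 1 - φ X := contDiff_const.sub hφ.1
  have hvk := fun k => (hv.smooth_mul hΩ hφ.1).add hΩ ((hG k).smooth_mul hΩ hφ')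
  have hvl := (hv.smooth_mul hΩ hφ.1).add hΩ (hg.smooth_mul hΩ hφ')
  set vk : ℕ → EuclideanSpace ℝ (Fin (n + 1)) → ℝ :=
    fun k X => φ X * v X + (1 - φ X) * u k X with hvk_def
  set F : ℕ → EuclideanSpace ℝ (Fin (n + 1)) → EuclideanSpace ℝ (Fin (n + 1)) := fun k X =>
    φ X • Gv X + v X • gradient φ X +
      ((1 - φ X) • G k X + u k X • gradient (fun X => 1 - φ X) X) with hF
  set Fl : EuclideanSpace ℝ (Fin (n + 1)) → EuclideanSpace ℝ (Fin (n + 1)) := fun X =>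
    φ X • Gv X + v X • gradient φ X +
      ((1 - φ X) • g X + uLim X • gradient (fun X => 1 - φ X) X) with hFl
  -- The limit of the glued functions is $\varphi v+(1-\varphi)u=v$ almost everywhere: on `K₀` the
  -- cutoff is one, and elsewhere $v=u$.
  have hFlGv : ∀ᵐ X ∂volume, X ∈ Ω → Fl X = Gv X := by
    refine hvl.1.ae_eq hΩ hv.1 ?_
    filter_upwards [hveq] with X hX hXΩ
    by_cases h : X ∈ K₀
    · rw [hV1 X (hKV h)]; ring
    · rw [hX ⟨hXΩ, h⟩]; ring
  have hF_lim : Tendsto (fun k => eLpNorm (F k - Fl) 2 (volume.restrict (closure D))) atTop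
      (𝓝 0) := by
    have hcg : Continuous (gradient fun X => 1 - φ X) := continuous_gradient hφ'
    obtain ⟨C, hC⟩ := hD3.exists_bound_of_continuousOn hcg.continuousOn
    have t1 : Tendsto (fun k => eLpNorm (fun X => (1 - φ X) • (G k - g) X) 2
        (volume.restrict (closure D))) atTop (𝓝 0) := by
      refine tendsto_eLpNorm_of_norm_le 1 (hGg _ hD3 hD4) fun k => Eventually.of_forall fun X => ?_
      rw [norm_smul]
      gcongr
      rw [Real.norm_eq_abs, abs_le]
      constructor <;> linarith [hφ0 X, hφ1 X]
    have t2 : Tendsto (fun k => eLpNorm (fun X => (u k - uLim) X • gradient (fun X => 1 - φ X) X) 2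
        (volume.restrict (closure D))) atTop (𝓝 0) := by
      refine tendsto_eLpNorm_of_norm_le C (memLp_limit hG hΩ hconv hD3 hD4).2 fun k => ?_
      filter_upwards [ae_restrict_mem hD3.measurableSet] with X hX
      rw [norm_smul, mul_comm]
      gcongr
      exact hC X hX
    refine tendsto_of_tendsto_of_tendsto_of_le_of_le tendsto_const_nhds
      (by simpa using t1.add t2) (fun _ => bot_le) fun k => ?_
    have he : F k - Fl = (fun X => (1 - φ X) • (G k - g) X) +
        fun X => (u k - uLim) X • gradient (fun X => 1 - φ X) X := by
      funext X
      simp only [hF, hFl, Pi.sub_apply, Pi.add_apply, smul_sub, sub_smul]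
      abel
    rw [he]
    refine eLpNorm_add_le ?_ ?_ (by norm_num)
    · exact (memLp_smul_of_continuous hD3 hφ'.continuous
        (((hG k).2 _ hD3 hD4).2.sub (hg.2 _ hD3 hD4).2)).1
    · exact (memLp_smul_of_continuous' hD3 hcg
        (((hG k).2 _ hD3 hD4).1.sub (hg.2 _ hD3 hD4).1)).1
  have hle : volume.restrict D ≤ volume.restrict (closure D) :=
    Measure.restrict_mono subset_closure le_rfl
  have lim1 : Tendsto (fun k => ∫ X in D, ‖G k X‖ ^ 2) atTop (𝓝 (∫ X in D, ‖g X‖ ^ 2)) :=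
    tendsto_integral_norm_sq (fun k => ((hG k).memLp hD).2) (hg.memLp hD).2
      (tendsto_of_tendsto_of_tendsto_of_le_of_le tendsto_const_nhds (hGg _ hD3 hD4)
        (fun _ => bot_le) fun k => eLpNorm_mono_measure _ hle)
  have lim2 : Tendsto (fun k => ∫ X in D, ‖F k X‖ ^ 2) atTop (𝓝 (∫ X in D, ‖Gv X‖ ^ 2)) := by
    have : ∫ X in D, ‖Gv X‖ ^ 2 = ∫ X in D, ‖Fl X‖ ^ 2 := by
      refine setIntegral_congr_ae hD1.measurableSet ?_
      filter_upwards [hFlGv] with X hX hXD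
      rw [hX (hDΩ hXD)]
    rw [this]
    exact tendsto_integral_norm_sq (fun k => ((hvk k).memLp hD).2) (hvl.memLp hD).2
      (tendsto_of_tendsto_of_tendsto_of_le_of_le tendsto_const_nhds hF_lim
        (fun _ => bot_le) fun k => eLpNorm_mono_measure _ hle)
  have lim3 := tendsto_measure_diff hΩ hD hu hG hg hp hconv
  have hPl : thinPositive uLim D = {x | thin x ∈ D ∧ 0 < uLim (thin x)} := by
    ext x
    refine ⟨fun ⟨hx, a, ha, hax⟩ => ⟨hx, ?_⟩, fun ⟨hx, hx'⟩ => ⟨hx, _, hx', hp _ (hDΩ hx)⟩⟩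
    exact tendsto_nhds_unique hax (hp _ (hDΩ hx)) ▸ ha
  have hPk : ∀ k, thinPositive (u k) D = {x | thin x ∈ D ∧ 0 < u k (thin x)} := fun k =>
    (hu k).thinPositive_eq hDΩ
  have hfin : ∀ w, volume (thinPositive w D) ≠ ⊤ := fun w => volume_thinPositive_ne_top hD.isBounded
  -- On `M` the glued competitor has the precise values of `v`; off `M` the functions `v` and `uLim`
  -- have the same ones.
  set M : Set (EuclideanSpace ℝ (Fin n)) := thin ⁻¹' V with hM
  have hMm : MeasurableSet M := (hV.preimage continuous_thin).measurableSet
  have split : ∀ w, volume.real (thinPositive w D) =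
      volume.real (thinPositive w D ∩ M) + volume.real (thinPositive w D \ M) := fun w =>
    (measureReal_inter_add_sdiff hMm (hfin w)).symm
  have inM : ∀ k, thinPositive (vk k) D ∩ M = thinPositive v D ∩ M := by
    intro k
    ext x
    refine and_congr_left fun hxM => and_congr_right fun hxD => exists_congr fun a =>
      and_congr_right fun _ => hasPreciseValue_congr hV hxM (Eventually.of_forall fun Y hY => ?_)
    simp [hvk_def, hV1 Y hY]
  have outM : ∀ k, thinPositive (vk k) D \ M ⊆
      (thinPositive (u k) D \ M) ∪ (thinPositive uLim D \ thinPositive (u k) D) := by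
    rintro k x ⟨⟨hxD, a, ha, hax⟩, hxM⟩
    have hxW : thin x ∈ Ω \ K₀ := ⟨hDΩ hxD, fun h => hxM (hKV h)⟩
    -- Off `K₀` the competitor is $\varphi u+(1-\varphi)u_k\le u+u_k$ almost everywhere, so a
    -- positive precise value needs $u>0$ or $u_k>0$ at the point.
    have hle : a ≤ uLim (thin x) + u k (thin x) := by
      refine HasPreciseValue.le hWo hxW ((hvk k).1.1.mono_set Set.sdiff_subset)
        ((hg.1.1.add (hG k).1.1).mono_set Set.sdiff_subset) ?_ hax
        (HasPreciseValue.add hΩ (hDΩ hxD) hg.1.1 (hG k).1.1 (hp _ (hDΩ hxD))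
          ((hu k).precise _ (hDΩ hxD)))
      filter_upwards [hveq] with Y hY hYW
      have e1 := h0 Y hYW.1
      have e2 := (hu k).nonneg Y hYW.1
      simp only [hY hYW, Pi.add_apply]
      nlinarith [hφ0 Y, hφ1 Y]
    by_cases hk : 0 < u k (thin x)
    · exact Or.inl ⟨by rw [hPk]; exact ⟨hxD, hk⟩, hxM⟩
    · refine Or.inr ⟨by rw [hPl]; exact ⟨hxD, by linarith⟩, ?_⟩
      rw [hPk]
      exact fun h => hk h.2
  have outv : thinPositive v D \ M = thinPositive uLim D \ M := by
    ext x
    refine and_congr_left fun hxM => and_congr_right fun hxD => exists_congr fun a =>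
      and_congr_right fun _ => hasPreciseValue_congr hWo ⟨hDΩ hxD, fun h => hxM (hKV h)⟩ hveq
  have inu : ∀ k, thinPositive uLim D ∩ M ⊆
      (thinPositive (u k) D ∩ M) ∪ (thinPositive uLim D \ thinPositive (u k) D) := by
    rintro k x ⟨h1, h2⟩
    by_cases h : x ∈ thinPositive (u k) D
    · exact Or.inl ⟨h, h2⟩
    · exact Or.inr ⟨h1, h⟩
  rw [energy_le_energy_iff hD hg hv, split uLim, split v, outv]
  have hsub : ∀ (A B C : Set (EuclideanSpace ℝ (Fin n))) , A ⊆ B ∪ C → volume B ≠ ⊤ →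
      volume C ≠ ⊤ → volume.real A ≤ volume.real B + volume.real C := fun A B C h hB hC =>
    (measureReal_mono h (measure_union_ne_top hB hC)).trans (measureReal_union_le _ _)
  have hne : ∀ w (A : Set (EuclideanSpace ℝ (Fin n))), A ⊆ thinPositive w D → volume A ≠ ⊤ :=
    fun w A h => ne_top_of_le_ne_top (hfin w) (measure_mono h)
  -- The area of $\{u_k>0\}$ off `M` cancels between the two sides. The factor 2 arises because the
  -- excess $\{u>0\}\setminus\{u_k>0\}$ is paid once in `outM` and once in `inu`.
  have main : ∀ k, (∫ X in D, ‖G k X‖ ^ 2) + volume.real (thinPositive uLim D ∩ M) ≤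
      (∫ X in D, ‖F k X‖ ^ 2) + volume.real (thinPositive v D ∩ M) +
        2 * volume.real (thinPositive uLim D \ thinPositive (u k) D) := by
    intro k
    have h1 := (hu k).minimizes.energy_le hD (hG k) (hvk k) hφ.2.1 hφ.2.2 (fun X _ hX => by
      simp [image_eq_zero_of_notMem_tsupport hX])
    have h2 := hsub _ _ _ (outM k) (hne (u k) _ Set.sdiff_subset) (hne uLim _ Set.sdiff_subset)
    have h3 := hsub _ _ _ (inu k) (hne (u k) _ Set.inter_subset_left) (hne uLim _ Set.sdiff_subset)
    have h4 := split (vk k)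
    have h5 := split (u k)
    rw [inM k] at h4
    linarith
  have hlim := le_of_tendsto_of_tendsto' (lim1.add_const _)
    ((lim2.add_const (volume.real (thinPositive v D ∩ M))).add
      (lim3.const_mul 2)) (fun k => by
        have := main k
        rwa [hPk, hPl] at this)
  rw [← hPl] at hlim
  linarith

/-- A locally uniform limit of minimizers is a minimizer. -/
theorem isMinimizer_of_tendsto (hΩ : IsOpen Ω) (hsymm : ∀ X ∈ Ω, reflectLast X ∈ Ω)
    (hu : ∀ k, IsMinimizer Ω (u k)) (hG : ∀ k, IsH1 Ω (u k) (G k)) (hg : IsH1 Ω uLim g)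
    (hconv : TendstoLocallyUniformlyOn u uLim atTop Ω)
    (hGg : ∀ K : Set (EuclideanSpace ℝ (Fin (n + 1))), IsCompact K → K ⊆ Ω →
      Tendsto (fun k => eLpNorm (G k - g) 2 (volume.restrict K)) atTop (𝓝 0)) :
    IsMinimizer Ω uLim := by
  have h0 : ∀ X ∈ Ω, 0 ≤ uLim X := fun X hX =>
    ge_of_tendsto' (hconv.tendsto_at hX) fun k => (hu k).nonneg X hX
  have hp : ∀ X ∈ Ω, HasPreciseValue uLim X (uLim X) := fun X hX =>
    hasPreciseValue_of_tendsto hΩ hconv (fun k => (hG k).1.1) hg.1.1 hX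
      fun k => (hu k).precise X hX
  refine ⟨h0, fun X hX => ?_, hp, isLocalMinimizer_of_tendsto hΩ hu hG hg hp h0 hconv hGg⟩
  refine tendsto_nhds_unique (hconv.tendsto_at (hsymm X hX))
    ((hconv.tendsto_at hX).congr fun k => ((hu k).even X hX).symm)

end LimitMinimality

/-! ### The mean value property of weakly harmonic functions -/

section MeanValue

variable {N : ℕ}

lemma fderiv_radial {k : ℝ → ℝ} (hk : Differentiable ℝ k) (x X e : EuclideanSpace ℝ (Fin N))
    (c : ℝ) : fderiv ℝ (fun X => k (‖X - x‖ ^ 2 / c)) X e =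
      deriv k (‖X - x‖ ^ 2 / c) * (2 * inner ℝ (X - x) e / c) := by
  have h1 : HasFDerivAt (fun X : EuclideanSpace ℝ (Fin N) => X - x)
      (ContinuousLinearMap.id ℝ _) X := (hasFDerivAt_id X).sub_const x
  have h2 := (h1.norm_sq.mul_const c⁻¹)
  have h3 := (hk (‖X - x‖ ^ 2 * c⁻¹)).hasDerivAt.comp_hasFDerivAt X h2
  simp only [div_eq_mul_inv]
  have h4 := h3.fderiv
  simp only [Function.comp_def] at h4
  rw [h4]
  simp [inner_sub_left, -mul_eq_mul_left_iff]
  ring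

lemma contDiff_radial {k : ℝ → ℝ} (hk : ContDiff ℝ ∞ k) (x : EuclideanSpace ℝ (Fin N))
    (c : ℝ) : ContDiff ℝ ∞ fun X : EuclideanSpace ℝ (Fin N) => k (‖X - x‖ ^ 2 / c) :=
  hk.comp (((contDiff_id.sub contDiff_const).norm_sq ℝ).div_const c)

lemma one_lt_div_of_notMem_closedBall {x X : EuclideanSpace ℝ (Fin N)} {s : ℝ} (hs : 0 < s)
    (hX : X ∉ Metric.closedBall x s) : 1 < ‖X - x‖ ^ 2 / s ^ 2 := by
  rw [Metric.mem_closedBall, not_le, dist_eq_norm] at hX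
  rw [one_lt_div (by positivity)]
  gcongr

lemma isTest_radial {k : ℝ → ℝ} (hk : ContDiff ℝ ∞ k) (hk1 : ∀ t, 1 ≤ t → k t = 0)
    (x : EuclideanSpace ℝ (Fin N)) {p : EuclideanSpace ℝ (Fin N) → ℝ} (hp : ContDiff ℝ ∞ p)
    {s R : ℝ} (hs : 0 < s) (hsR : s < R) :
    IsTest (Metric.ball x R) fun X => p X * k (‖X - x‖ ^ 2 / s ^ 2) := by
  have hsupp : Function.support (fun X => p X * k (‖X - x‖ ^ 2 / s ^ 2)) ⊆
      Metric.closedBall x s := fun X hX => by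
    by_contra h
    exact hX (by simp [hk1 _ (one_lt_div_of_notMem_closedBall hs h).le])
  have hts := closure_minimal hsupp Metric.isClosed_closedBall
  exact ⟨hp.mul (contDiff_radial hk x _),
    (isCompact_closedBall x s).of_isClosed_subset (isClosed_tsupport _) hts,
    hts.trans (Metric.closedBall_subset_ball hsR)⟩

variable {x : EuclideanSpace ℝ (Fin N)} {R : ℝ} {u : EuclideanSpace ℝ (Fin N) → ℝ}
  {G : EuclideanSpace ℝ (Fin N) → EuclideanSpace ℝ (Fin N)}

/-- Integrating from 1 keeps the primitive zero on $[1,\infty)$, so it yields a compactly supported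
radial test function whose gradient is a multiple of $h\,(X-x)$. -/
lemma exists_primitive {h : ℝ → ℝ} (hh : ContDiff ℝ ∞ h) (h1 : ∀ t, 1 ≤ t → h t = 0) :
    ∃ H : ℝ → ℝ, ContDiff ℝ ∞ H ∧ (∀ t, 1 ≤ t → H t = 0) ∧ ∀ t, deriv H t = h t := by
  have hd : ∀ t, HasDerivAt (fun t => ∫ y in (1 : ℝ)..t, h y) (h t) t := fun t =>
    hh.continuous.integral_hasStrictDerivAt 1 t |>.hasDerivAt
  have hd' : deriv (fun t => ∫ y in (1 : ℝ)..t, h y) = h := funext fun t => (hd t).deriv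
  refine ⟨fun t => ∫ y in (1 : ℝ)..t, h y, ?_, fun t ht => ?_, fun t => (hd t).deriv⟩
  · rw [contDiff_infty_iff_deriv, hd']
    exact ⟨fun t => (hd t).differentiableAt, hh⟩
  · refine (intervalIntegral.integral_congr fun y hy => ?_).trans intervalIntegral.integral_zero
    rw [Set.uIcc_of_le ht] at hy
    exact h1 y hy.1

/-- The weak form of `∫ u div((X - x) h) = -∫ h ⟨∇u, X - x⟩ = 0` for harmonic `u`. -/
lemma integral_radial_divergence (hu : HasWeakGradient (Metric.ball x R) u G)
    (hharm : ∀ φ, IsTest (Metric.ball x R) φ →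
      ∫ X in Metric.ball x R, inner ℝ (G X) (gradient φ X) = 0)
    {h : ℝ → ℝ} (hh : ContDiff ℝ ∞ h) (h1 : ∀ t, 1 ≤ t → h t = 0) {s : ℝ} (hs : 0 < s)
    (hsR : s < R) :
    ∫ X, u X * (N * h (‖X - x‖ ^ 2 / s ^ 2) +
      deriv h (‖X - x‖ ^ 2 / s ^ 2) * (2 * ‖X - x‖ ^ 2 / s ^ 2)) = 0 := by
  obtain ⟨H, hH, hH1, hHd⟩ := exists_primitive hh h1
  let e : Fin N → EuclideanSpace ℝ (Fin N) := fun i => EuclideanSpace.single i 1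
  have hin : ∀ (i : Fin N) (Y : EuclideanSpace ℝ (Fin N)), inner ℝ Y (e i) = Y i := fun i Y => by
    simp [e, EuclideanSpace.inner_single_right]
  have hp : ∀ i, ContDiff ℝ ∞ fun X : EuclideanSpace ℝ (Fin N) => inner ℝ (X - x) (e i) :=
    fun i => (contDiff_id.sub contDiff_const).inner ℝ contDiff_const
  have ht := fun i => isTest_radial hh h1 x (hp i) hs hsR
  have hf : ∀ i X, fderiv ℝ (fun X => inner ℝ (X - x) (e i) * h (‖X - x‖ ^ 2 / s ^ 2)) X (e i) =
      h (‖X - x‖ ^ 2 / s ^ 2) +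
        deriv h (‖X - x‖ ^ 2 / s ^ 2) * (2 * ((X - x) i) ^ 2 / s ^ 2) := by
    intro i X
    rw [fderiv_mul_apply (hp i) (contDiff_radial hh x _), fderiv_radial (hh.differentiable (by simp))]
    have h2 : HasFDerivAt (fun X : EuclideanSpace ℝ (Fin N) => inner ℝ (X - x) (e i))
        (innerSL ℝ (e i)) X := by
      have := (innerSL ℝ (e i)).hasFDerivAt.comp X ((hasFDerivAt_id X).sub_const x)
      refine this.congr_of_eventuallyEq (Eventually.of_forall fun Y => ?_)
      simp [real_inner_comm]
    rw [h2.fderiv, hin, innerSL_apply_apply, hin]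
    have : e i i = 1 := by simp [e]
    rw [this]
    ring
  have hsum : ∀ X : EuclideanSpace ℝ (Fin N), ∑ i, ((X - x) i) ^ 2 = ‖X - x‖ ^ 2 := fun X => by
    rw [EuclideanSpace.norm_sq_eq]; simp
  -- The factor $s^2/2$ normalizes the gradient of this function to exactly $h(|X-x|^2/s^2)(X-x)$,
  -- so harmonicity kills its pairing with $\nabla u$.
  have hψ : IsTest (Metric.ball x R) fun X => s ^ 2 / 2 * H (‖X - x‖ ^ 2 / s ^ 2) :=
    isTest_radial hH hH1 x contDiff_const hs hsR
  have hgrad : ∀ X, gradient (fun X => s ^ 2 / 2 * H (‖X - x‖ ^ 2 / s ^ 2)) X =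
      h (‖X - x‖ ^ 2 / s ^ 2) • (X - x) := by
    intro X
    refine ext_inner_right ℝ fun v => ?_
    rw [← fderiv_eq_inner_gradient, inner_smul_left, fderiv_const_mul
      ((contDiff_radial hH x _).differentiable (by simp) X)]
    simp only [smul_apply, smul_eq_mul,
      fderiv_radial (hH.differentiable (by simp)), hHd, RCLike.conj_to_real]
    field_simp
  have hz := hharm _ hψ
  have hz' : ∫ X, inner ℝ (G X) (h (‖X - x‖ ^ 2 / s ^ 2) • (X - x)) = 0 := by
    rw [← hz, setIntegral_eq_integral_of_forall_compl_eq_zero]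
    · simp only [hgrad]
    · intro X hX
      rw [gradient_zero_of_notMem_tsupport fun h' => hX (hψ.2.2 h'), inner_zero_right]
  have hint : ∀ i, ∫ X, u X * (h (‖X - x‖ ^ 2 / s ^ 2) +
        deriv h (‖X - x‖ ^ 2 / s ^ 2) * (2 * ((X - x) i) ^ 2 / s ^ 2)) =
      -∫ X, inner ℝ (X - x) (e i) * h (‖X - x‖ ^ 2 / s ^ 2) * inner ℝ (G X) (e i) := by
    intro i
    rw [← hu.integral_eq (ht i) (e i)]
    simp only [hf]
  have hi1 : ∀ i, Integrable (fun X => u X * (h (‖X - x‖ ^ 2 / s ^ 2) +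
        deriv h (‖X - x‖ ^ 2 / s ^ 2) * (2 * ((X - x) i) ^ 2 / s ^ 2))) volume := by
    intro i
    have := (ht i).integrable_mul_fderiv hu.1 (e i)
    simpa only [hf] using this
  have hi2 := fun i => (ht i).integrable_mul_inner hu.2.1 (e i)
  calc _ = ∫ X, ∑ i, u X * (h (‖X - x‖ ^ 2 / s ^ 2) +
        deriv h (‖X - x‖ ^ 2 / s ^ 2) * (2 * ((X - x) i) ^ 2 / s ^ 2)) := by
        refine integral_congr_ae (Eventually.of_forall fun X => ?_)
        simp only
        rw [← Finset.mul_sum, Finset.sum_add_distrib, ← Finset.mul_sum, ← Finset.sum_div,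
          ← Finset.mul_sum, hsum]
        simp
    _ = ∑ i, -∫ X, inner ℝ (X - x) (e i) * h (‖X - x‖ ^ 2 / s ^ 2) * inner ℝ (G X) (e i) := by
        rw [integral_finsetSum _ fun i _ => hi1 i]
        exact Finset.sum_congr rfl fun i _ => hint i
    _ = -∫ X, inner ℝ (G X) (h (‖X - x‖ ^ 2 / s ^ 2) • (X - x)) := by
        rw [Finset.sum_neg_distrib, ← integral_finsetSum _ fun i _ => hi2 i]
        congr 1
        refine integral_congr_ae (Eventually.of_forall fun X => ?_)
        simp only [hin, inner_smul_right]
        rw [PiLp.inner_apply, Finset.mul_sum]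
        refine Finset.sum_congr rfl fun i _ => ?_
        simp
        ring
    _ = 0 := by rw [hz', neg_zero]

/-- Differentiation under the integral sign. For radii $t\in(s/2,s_2)$ the factor $h'(|X-x|^2/t^2)$
vanishes when $|X-x|>t$, and otherwise $2|X-x|^2/t^3\le2/t\le4/s$, which gives an integrable
majorant. -/
lemma hasDerivAt_integral_radial (hu : LocallyIntegrableOn u (Metric.ball x R) volume)
    {h : ℝ → ℝ} (hh : ContDiff ℝ ∞ h) (h1 : ∀ t, 1 ≤ t → h t = 0) {s : ℝ} (hs : 0 < s)
    (hsR : s < R) :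
    Integrable
        (fun X => u X * (deriv h (‖X - x‖ ^ 2 / s ^ 2) * (-(2 * ‖X - x‖ ^ 2 / s ^ 3)))) volume ∧
    HasDerivAt (fun s => ∫ X, u X * h (‖X - x‖ ^ 2 / s ^ 2))
      (∫ X, u X * (deriv h (‖X - x‖ ^ 2 / s ^ 2) * (-(2 * ‖X - x‖ ^ 2 / s ^ 3)))) s := by
  have hd1 : ∀ t, 1 < t → deriv h t = 0 := fun t ht => by
    have : h =ᶠ[𝓝 t] fun _ => 0 := by
      filter_upwards [lt_mem_nhds ht] with y hy using h1 y hy.le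
    rw [this.deriv_eq, deriv_const]
  obtain ⟨M, hM⟩ := (isCompact_Icc (a := (0 : ℝ)) (b := 1)).exists_bound_of_continuousOn
    (hh.continuous_deriv (by simp)).continuousOn
  have hM0 : 0 ≤ M := (norm_nonneg _).trans (hM 0 (by simp))
  obtain ⟨s₂, hs2, hs2R⟩ := exists_between hsR
  have hint : ∀ s, 0 < s → s < R →
      Integrable (fun X => u X * h (‖X - x‖ ^ 2 / s ^ 2)) volume := fun s hs hsR => by
    have := (isTest_radial hh h1 x (p := fun _ => 1) contDiff_const hs hsR).integrable_mul hu
    simpa [mul_comm] using this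
  have hmem : Set.Ioo (s / 2) s₂ ∈ 𝓝 s := Ioo_mem_nhds (by linarith) hs2
  have huB : IntegrableOn u (Metric.closedBall x s₂) volume :=
    hu.integrableOn_compact_subset (Metric.closedBall_subset_ball hs2R) (isCompact_closedBall _ _)
  refine hasDerivAt_integral_of_dominated_loc_of_deriv_le (μ := volume)
    (F := fun s X => u X * h (‖X - x‖ ^ 2 / s ^ 2))
    (F' := fun s X => u X * (deriv h (‖X - x‖ ^ 2 / s ^ 2) * (-(2 * ‖X - x‖ ^ 2 / s ^ 3))))
    (bound := (Metric.closedBall x s₂).indicator fun X => ‖u X‖ * (M * (4 / s)))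
    hmem ?_ (hint s hs hsR) ?_ (Eventually.of_forall fun X t ht => ?_) ?_
    (Eventually.of_forall fun X t ht => ?_)
  · filter_upwards [hmem] with t ht
    exact (hint t (by linarith [ht.1]) (ht.2.trans hs2R)).1
  · have hsupp : ∀ X ∉ Metric.closedBall x s, deriv h (‖X - x‖ ^ 2 / s ^ 2) *
        (-(2 * ‖X - x‖ ^ 2 / s ^ 3)) = 0 := fun X hX => by
      rw [hd1 _ (one_lt_div_of_notMem_closedBall hs hX), zero_mul]
    have := integrable_smul_of_tsupport_subset hu
      (g := fun X => deriv h (‖X - x‖ ^ 2 / s ^ 2) * (-(2 * ‖X - x‖ ^ 2 / s ^ 3)))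
      (((hh.continuous_deriv (by simp)).comp (by fun_prop)).mul (by fun_prop))
      (isCompact_closedBall x s) (Metric.closedBall_subset_ball hsR) hsupp
    simpa only [smul_eq_mul, mul_comm] using this.1
  · have ht0 : 0 < t := by linarith [ht.1]
    by_cases hX : X ∈ Metric.closedBall x s₂
    · rw [Set.indicator_of_mem hX, norm_mul]
      gcongr
      by_cases hq : ‖X - x‖ ^ 2 / t ^ 2 ≤ 1
      · rw [norm_mul]
        have e1 : ‖-(2 * ‖X - x‖ ^ 2 / t ^ 3)‖ = ‖X - x‖ ^ 2 / t ^ 2 * (2 / t) := by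
          rw [norm_neg, Real.norm_of_nonneg (by positivity)]
          field_simp
        rw [e1]
        have e2 : 2 / t ≤ 4 / s := by
          rw [div_le_div_iff₀ ht0 hs]; linarith [ht.1]
        calc _ ≤ M * (1 * (4 / s)) := by
              gcongr
              exact hM _ ⟨by positivity, hq⟩
          _ = _ := by ring
      · rw [hd1 _ (not_le.1 hq), zero_mul, norm_zero]
        positivity
    · have hX' : X ∉ Metric.closedBall x t := fun h =>
        hX (Metric.closedBall_subset_closedBall ht.2.le h)
      rw [hd1 _ (one_lt_div_of_notMem_closedBall ht0 hX'), Set.indicator_of_notMem hX]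
      simp
  · exact (integrable_indicator_iff Metric.isClosed_closedBall.measurableSet).2
      (huB.norm.mul_const _)
  · have ht0 : t ≠ 0 := by linarith [ht.1]
    have e1 : HasDerivAt (fun t : ℝ => ‖X - x‖ ^ 2 / t ^ 2) (-(2 * ‖X - x‖ ^ 2 / t ^ 3)) t := by
      have := ((hasDerivAt_pow 2 t).inv (pow_ne_zero 2 ht0)).const_mul (‖X - x‖ ^ 2)
      simp only [div_eq_mul_inv]
      refine this.congr_deriv ?_
      field_simp
      simp
      ring
    exact ((hh.differentiable (by simp) _).hasDerivAt.comp t e1).const_mul (u X)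

/-- The radial averages of a weakly harmonic function are independent of the radius. -/
lemma radial_average_eq (hu : HasWeakGradient (Metric.ball x R) u G)
    (hharm : ∀ φ, IsTest (Metric.ball x R) φ →
      ∫ X in Metric.ball x R, inner ℝ (G X) (gradient φ X) = 0)
    {h : ℝ → ℝ} (hh : ContDiff ℝ ∞ h) (h1 : ∀ t, 1 ≤ t → h t = 0) {r s : ℝ} (hr : 0 < r)
    (hrR : r < R) (hs : 0 < s) (hsR : s < R) :
    (∫ X, u X * h (‖X - x‖ ^ 2 / r ^ 2)) / r ^ N =
      (∫ X, u X * h (‖X - x‖ ^ 2 / s ^ 2)) / s ^ N := by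
  have hder : ∀ t ∈ Set.Ioo 0 R, HasDerivAt
      (fun t => (∫ X, u X * h (‖X - x‖ ^ 2 / t ^ 2)) / t ^ N) 0 t := by
    intro t ht
    have ht0 : t ≠ 0 := ht.1.ne'
    obtain ⟨hgi, hg⟩ := hasDerivAt_integral_radial hu.1 hh h1 ht.1 ht.2
    have hdiv := integral_radial_divergence hu hharm hh h1 ht.1 ht.2
    have hint : Integrable (fun X => u X * h (‖X - x‖ ^ 2 / t ^ 2)) volume := by
      have := (isTest_radial hh h1 x (p := fun _ => 1) contDiff_const ht.1 ht.2).integrable_mul hu.1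
      simpa [mul_comm] using this
    -- The divergence identity turns the radial derivative of $I(t)=\int u\,h(|X-x|^2/t^2)$ into
    -- $I'=NI/t$, so $I/t^N$ has zero derivative.
    have key : ∫ X, u X * (deriv h (‖X - x‖ ^ 2 / t ^ 2) * (-(2 * ‖X - x‖ ^ 2 / t ^ 3))) =
        N / t * ∫ X, u X * h (‖X - x‖ ^ 2 / t ^ 2) := by
      have e : ∀ X, u X * (deriv h (‖X - x‖ ^ 2 / t ^ 2) * (-(2 * ‖X - x‖ ^ 2 / t ^ 3))) =
          N / t * (u X * h (‖X - x‖ ^ 2 / t ^ 2)) - 1 / t * (u X * (N * h (‖X - x‖ ^ 2 / t ^ 2) +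
            deriv h (‖X - x‖ ^ 2 / t ^ 2) * (2 * ‖X - x‖ ^ 2 / t ^ 2))) := by
        intro X; field_simp; ring
      have hi : Integrable (fun X => u X * (N * h (‖X - x‖ ^ 2 / t ^ 2) +
            deriv h (‖X - x‖ ^ 2 / t ^ 2) * (2 * ‖X - x‖ ^ 2 / t ^ 2))) volume := by
        refine ((hint.const_mul N).sub (hgi.const_mul t)).congr (Eventually.of_forall fun X => ?_)
        simp only [Pi.sub_apply]
        field_simp
        ring
      simp only [e]
      rw [integral_sub (hint.const_mul _) (hi.const_mul _), integral_const_mul,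
        integral_const_mul, hdiv]
      ring
    have hq := hg.div (hasDerivAt_pow N t) (pow_ne_zero N ht0)
    refine hq.congr_deriv ?_
    rw [key, div_eq_zero_iff]
    left
    rcases N with _ | N
    · simp
    · rw [Nat.add_sub_cancel, pow_succ]
      field_simp
      ring
  refine isOpen_Ioo.is_const_of_deriv_eq_zero isPreconnected_Ioo
    (fun t ht => (hder t ht).differentiableAt.differentiableWithinAt)
    (fun t ht => (hder t ht).deriv) (⟨hr, hrR⟩ : r ∈ Set.Ioo 0 R) (⟨hs, hsR⟩ : s ∈ Set.Ioo 0 R)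

/-- The mean value property in weak form. -/
lemma setIntegral_ball_eq (hu : HasWeakGradient (Metric.ball x R) u G)
    (hharm : ∀ φ, IsTest (Metric.ball x R) φ →
      ∫ X in Metric.ball x R, inner ℝ (G X) (gradient φ X) = 0) {r s : ℝ} (hr : 0 < r)
    (hrR : r < R) (hs : 0 < s) (hsR : s < R) :
    (∫ X in Metric.ball x r, u X) / r ^ N = (∫ X in Metric.ball x s, u X) / s ^ N := by
  -- Smooth profiles with values in $[0,1]$ that converge pointwise to the indicator of $t<1$.
  let h : ℕ → ℝ → ℝ := fun j t => Real.smoothTransition ((j : ℝ) * (1 - t))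
  have hh : ∀ j, ContDiff ℝ ∞ (h j) := fun j =>
    Real.smoothTransition.contDiff.comp (contDiff_const.mul (contDiff_const.sub contDiff_id))
  have h1 : ∀ j t, 1 ≤ t → h j t = 0 := fun j t ht =>
    Real.smoothTransition.zero_of_nonpos (mul_nonpos_of_nonneg_of_nonpos j.cast_nonneg (by linarith))
  have hlim : ∀ t : ℝ, t < 1 → ∀ᶠ j in atTop, h j t = 1 := fun t ht => by
    obtain ⟨m, hm⟩ := exists_nat_ge (1 / (1 - t))
    filter_upwards [eventually_ge_atTop m] with j hj
    refine Real.smoothTransition.one_of_one_le ?_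
    have h2 : 0 < 1 - t := by linarith
    rw [div_le_iff₀ h2] at hm
    exact hm.trans (by gcongr)
  have key : ∀ t, 0 < t → t < R → Tendsto (fun j => ∫ X, u X * h j (‖X - x‖ ^ 2 / t ^ 2)) atTop
      (𝓝 (∫ X in Metric.ball x t, u X)) := by
    intro t ht htR
    have huB : IntegrableOn u (Metric.closedBall x t) volume :=
      hu.1.integrableOn_compact_subset (Metric.closedBall_subset_ball htR) (isCompact_closedBall _ _)
    rw [← integral_indicator Metric.isOpen_ball.measurableSet]
    refine tendsto_integral_of_dominated_convergence
      ((Metric.closedBall x t).indicator fun X => ‖u X‖) (fun j => ?_)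
      ((integrable_indicator_iff Metric.isClosed_closedBall.measurableSet).2 huB.norm)
      (fun j => Eventually.of_forall fun X => ?_) (Eventually.of_forall fun X => ?_)
    · have := (isTest_radial (hh j) (h1 j) x (p := fun _ => 1) contDiff_const ht htR).integrable_mul
        hu.1
      simpa [mul_comm] using this.1
    · by_cases hX : X ∈ Metric.closedBall x t
      · rw [Set.indicator_of_mem hX, norm_mul]
        refine mul_le_of_le_one_right (norm_nonneg _) ?_
        rw [Real.norm_of_nonneg (Real.smoothTransition.nonneg _)]
        exact Real.smoothTransition.le_one _
      · rw [h1 j _ (one_lt_div_of_notMem_closedBall ht hX).le, Set.indicator_of_notMem hX]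
        simp
    · by_cases hX : X ∈ Metric.ball x t
      · rw [Set.indicator_of_mem hX]
        refine tendsto_const_nhds.congr' ?_
        have : ‖X - x‖ ^ 2 / t ^ 2 < 1 := by
          rw [Metric.mem_ball, dist_eq_norm] at hX
          rw [div_lt_one (by positivity)]
          gcongr
        filter_upwards [hlim _ this] with j hj
        rw [hj, mul_one]
      · rw [Set.indicator_of_notMem hX]
        refine tendsto_const_nhds.congr fun j => ?_
        have : 1 ≤ ‖X - x‖ ^ 2 / t ^ 2 := by
          rw [Metric.mem_ball, dist_eq_norm, not_lt] at hX
          rw [one_le_div (by positivity)]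
          gcongr
        rw [h1 j _ this, mul_zero]
  exact tendsto_nhds_unique (((key r hr hrR).div_const _).congr fun j =>
    radial_average_eq hu hharm (hh j) (h1 j) hr hrR hs hsR) ((key s hs hsR).div_const _)

/-- The mean value property at points where a weakly harmonic function has a precise value. -/
lemma HasPreciseValue.setIntegral_ball (hu : HasWeakGradient (Metric.ball x R) u G)
    (hharm : ∀ φ, IsTest (Metric.ball x R) φ →
      ∫ X in Metric.ball x R, inner ℝ (G X) (gradient φ X) = 0) {s a : ℝ} (hs : 0 < s)
    (hsR : s < R) (ha : HasPreciseValue u x a) :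
    ∫ X in Metric.ball x s, u X = volume.real (Metric.ball x s) * a := by
  have hv : ∀ r : ℝ, 0 < r → volume.real (Metric.ball x r) =
      r ^ N * volume.real (Metric.ball (0 : EuclideanSpace ℝ (Fin N)) 1) := fun r hr => by
    rw [measureReal_def, measureReal_def, Measure.addHaar_ball_of_pos volume x hr,
      ENNReal.toReal_mul, ENNReal.toReal_ofReal (by positivity), finrank_euclideanSpace_fin]
  have hb : 0 < volume.real (Metric.ball (0 : EuclideanSpace ℝ (Fin N)) 1) := by
    rw [measureReal_def]
    exact ENNReal.toReal_pos (Metric.measure_ball_pos _ _ one_pos).ne' measure_ball_lt_top.ne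
  have havg : ∀ r : ℝ, 0 < r → ⨍ Y in Metric.ball x r, u Y =
      ((∫ X in Metric.ball x r, u X) / r ^ N) /
        volume.real (Metric.ball (0 : EuclideanSpace ℝ (Fin N)) 1) := fun r hr => by
    rw [setAverage_eq, hv r hr, smul_eq_mul]
    field_simp
  -- The ball averages do not depend on the radius, so their limit, the precise value, is the
  -- average at radius `s`.
  have h1 : Tendsto (fun r : ℝ => ⨍ Y in Metric.ball x r, u Y) (𝓝[>] 0)
      (𝓝 (⨍ Y in Metric.ball x s, u Y)) := by
    refine tendsto_const_nhds.congr' ?_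
    filter_upwards [Ioo_mem_nhdsGT (hs.trans hsR)] with r hr
    rw [havg r hr.1, havg s hs, setIntegral_ball_eq hu hharm hs hsR hr.1 hr.2]
  have h2 := tendsto_nhds_unique ha h1
  rw [h2, havg s hs, hv s hs]
  have := pow_pos hs N
  field_simp

end MeanValue

/-! ### Harnack estimates and vanishing of minimizers -/

section ZeroSets

variable {n : ℕ} {Ω : Set (EuclideanSpace ℝ (Fin (n + 1)))}
  {w : EuclideanSpace ℝ (Fin (n + 1)) → ℝ}

lemma IsMinimizer.exists_isH1 (h : IsMinimizer Ω w) : ∃ G, IsH1 Ω w G := h.minimizes.1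

lemma volume_real_ball_pos {N : ℕ} (X : EuclideanSpace ℝ (Fin N)) {r : ℝ} (hr : 0 < r) :
    0 < volume.real (Metric.ball X r) :=
  ENNReal.toReal_pos (Metric.measure_ball_pos _ _ hr).ne' measure_ball_lt_top.ne

lemma IsMinimizer.setIntegral_ball (h : IsMinimizer Ω w) (hΩ : IsOpen Ω)
    {X : EuclideanSpace ℝ (Fin (n + 1))} {s R : ℝ} (hs : 0 < s) (hsR : s < R)
    (hR : Metric.closedBall X R ⊆ Ω)
    (hpos : ∀ y, thin y ∈ Metric.ball X R → 0 < w (thin y)) :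
    ∫ Y in Metric.ball X s, w Y = volume.real (Metric.ball X s) * w X := by
  obtain ⟨G, hG⟩ := h.exists_isH1
  have hR0 := hs.trans hsR
  exact HasPreciseValue.setIntegral_ball
    (hG.1.mono (Metric.ball_subset_closedBall.trans hR))
    (fun φ hφ => h.integral_inner_eq_zero hΩ (isSubdomain_ball hR0 hR) hG hpos hφ) hs hsR
    (h.precise X (hR (Metric.mem_closedBall_self hR0.le)))

lemma IsMinimizer.locallyIntegrableOn (h : IsMinimizer Ω w) : LocallyIntegrableOn w Ω volume :=
  h.exists_isH1.choose_spec.1.1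

/-- Precise values upgrade almost everywhere vanishing on an open set to vanishing at every point,
including points of the hyperplane. -/
lemma IsMinimizer.eq_zero_of_ae (h : IsMinimizer Ω w) {W : Set (EuclideanSpace ℝ (Fin (n + 1)))}
    (hW : IsOpen W) (hWΩ : W ⊆ Ω) (h0 : ∀ᵐ X ∂volume, X ∈ W → w X = 0) : ∀ X ∈ W, w X = 0 := by
  intro X hX
  have h1 := (hasPreciseValue_congr (v := w) (u := fun _ => 0) hW hX h0).1 (h.precise X (hWΩ hX))
  refine tendsto_nhds_unique h1 ?_
  simp only [average_zero]
  exact tendsto_const_nhds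

lemma IsMinimizer.eq_zero_of_setIntegral_le (h : IsMinimizer Ω w)
    {X : EuclideanSpace ℝ (Fin (n + 1))} {s : ℝ} (hs : Metric.closedBall X s ⊆ Ω)
    (hint : ∫ Y in Metric.ball X s, w Y ≤ 0) : ∀ Y ∈ Metric.ball X s, w Y = 0 := by
  have hsub : Metric.ball X s ⊆ Ω := Metric.ball_subset_closedBall.trans hs
  have hnn : 0 ≤ᵐ[volume.restrict (Metric.ball X s)] w := by
    filter_upwards [ae_restrict_mem Metric.isOpen_ball.measurableSet] with Y hY
      using h.nonneg Y (hsub hY)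
  have h0 := (setIntegral_eq_zero_iff_of_nonneg_ae hnn
    (integrableOn_ball h.locallyIntegrableOn hs)).1
    (le_antisymm hint (integral_nonneg_of_ae hnn))
  rw [EventuallyEq, ae_restrict_iff' Metric.isOpen_ball.measurableSet] at h0
  exact h.eq_zero_of_ae Metric.isOpen_ball hsub h0

/-- A minimizer that vanishes at the centre of a ball of harmonicity vanishes in the ball. -/
lemma IsMinimizer.eq_zero_ball (h : IsMinimizer Ω w) (hΩ : IsOpen Ω)
    {X : EuclideanSpace ℝ (Fin (n + 1))} {s R : ℝ} (hs : 0 < s) (hsR : s < R)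
    (hR : Metric.closedBall X R ⊆ Ω)
    (hpos : ∀ y, thin y ∈ Metric.ball X R → 0 < w (thin y)) (hX : w X = 0) :
    ∀ Y ∈ Metric.ball X s, w Y = 0 := by
  refine h.eq_zero_of_setIntegral_le ((Metric.closedBall_subset_closedBall hsR.le).trans hR) ?_
  rw [h.setIntegral_ball hΩ hs hsR hR hpos, hX, mul_zero]

/-- A weak Harnack inequality. -/
lemma IsMinimizer.setIntegral_le (h : IsMinimizer Ω w) (hΩ : IsOpen Ω)
    {X Y : EuclideanSpace ℝ (Fin (n + 1))} {R : ℝ} (hR0 : 0 < R)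
    (hR : Metric.closedBall X R ⊆ Ω)
    (hpos : ∀ y, thin y ∈ Metric.ball X R → 0 < w (thin y)) (hY : Y ∈ Metric.ball X (R / 4)) :
    ∫ Z in Metric.ball X (R / 4), w Z ≤
      volume.real (Metric.ball (0 : EuclideanSpace ℝ (Fin (n + 1))) (R / 2)) * w Y := by
  rw [Metric.mem_ball] at hY
  -- The mean value over `B_{R/2}(Y)`, which contains `B_{R/4}(X)`, needs harmonicity in a slightly
  -- larger ball. The radius $5R/8$ works, as $5/8+1/4<1$.
  have h1 : Metric.closedBall Y (5 * R / 8) ⊆ Metric.ball X R := fun Z hZ => by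
    rw [Metric.mem_closedBall] at hZ
    rw [Metric.mem_ball]
    linarith [dist_triangle Z Y X]
  have h2 : Metric.ball X (R / 4) ⊆ Metric.ball Y (R / 2) := fun Z hZ => by
    rw [Metric.mem_ball] at hZ ⊢
    linarith [dist_triangle Z X Y, dist_comm X Y]
  have h3 : Metric.closedBall Y (5 * R / 8) ⊆ Ω :=
    h1.trans (Metric.ball_subset_closedBall.trans hR)
  have h4 : Metric.closedBall Y (R / 2) ⊆ Ω :=
    (Metric.closedBall_subset_closedBall (by linarith)).trans h3
  have h5 := h.setIntegral_ball hΩ (X := Y) (s := R / 2) (R := 5 * R / 8) (by linarith)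
    (by linarith) h3 fun y hy => hpos y (h1 (Metric.ball_subset_closedBall hy))
  rw [Measure.addHaar_real_ball_center] at h5
  rw [← h5]
  refine setIntegral_mono_set (integrableOn_ball h.locallyIntegrableOn h4) ?_ h2.eventuallyLE
  filter_upwards [ae_restrict_mem Metric.isOpen_ball.measurableSet] with Z hZ
    using h.nonneg Z (h4 (Metric.ball_subset_closedBall hZ))

/-- The mean value at `X` makes the integral over `B_{R/4}(X)` positive, and the Harnack estimate
bounds it by a multiple of the value at any `Y`. -/
lemma IsMinimizer.exists_pos_lower_bound (h : IsMinimizer Ω w) (hΩ : IsOpen Ω)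
    {X : EuclideanSpace ℝ (Fin (n + 1))} {R : ℝ} (hR0 : 0 < R)
    (hR : Metric.closedBall X R ⊆ Ω)
    (hpos : ∀ y, thin y ∈ Metric.ball X R → 0 < w (thin y)) (hX : 0 < w X) :
    ∃ c > 0, ∀ Y ∈ Metric.ball X (R / 4), c ≤ w Y := by
  have v1 := volume_real_ball_pos X (show 0 < R / 4 by linarith)
  have v2 := volume_real_ball_pos (0 : EuclideanSpace ℝ (Fin (n + 1))) (show 0 < R / 2 by linarith)
  refine ⟨volume.real (Metric.ball X (R / 4)) * w X /
    volume.real (Metric.ball (0 : EuclideanSpace ℝ (Fin (n + 1))) (R / 2)), by positivity,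
    fun Y hY => ?_⟩
  have h1 := h.setIntegral_le hΩ hR0 hR hpos hY
  rw [h.setIntegral_ball hΩ (by linarith) (by linarith) hR hpos] at h1
  rw [div_le_iff₀ v2]
  linarith

/-! ### Strong maximum principle and unique continuation across the hyperplane -/

section Propagation

lemma isOpen_off_thin : IsOpen {X : EuclideanSpace ℝ (Fin (n + 1)) | X (Fin.last n) ≠ 0} :=
  isOpen_ne_fun (by fun_prop) continuous_const

/-- Strong maximum principle. Balls in `P` miss the hyperplane, so positivity there is vacuous and
each zero spreads to a ball of controlled radius. The interior of the zero set is thus closed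
relative to `P`. -/
lemma IsMinimizer.eq_zero_of_isPreconnected (h : IsMinimizer Ω w) (hΩ : IsOpen Ω)
    {P : Set (EuclideanSpace ℝ (Fin (n + 1)))} (hP : IsOpen P) (hPc : IsPreconnected P)
    (hPΩ : P ⊆ Ω) (hPt : ∀ X ∈ P, X (Fin.last n) ≠ 0) {X₀ : EuclideanSpace ℝ (Fin (n + 1))}
    (hX₀ : X₀ ∈ P) (h0 : w X₀ = 0) : ∀ X ∈ P, w X = 0 := by
  have hball : ∀ X ∈ P, w X = 0 → ∀ r R, 0 < r → r < R → Metric.closedBall X R ⊆ P →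
      ∀ Y ∈ Metric.ball X r, w Y = 0 := fun X _ hX0 r R hr hrR hR =>
    h.eq_zero_ball hΩ hr hrR (hR.trans hPΩ)
      (fun y hy => absurd (thin_apply_last y) (hPt _ (hR (Metric.ball_subset_closedBall hy)))) hX0
  have hsub : P ⊆ {X | ∀ᶠ Y in 𝓝 X, w Y = 0} := by
    refine hPc.subset_of_closure_inter_subset isOpen_setOfPred_eventually_nhds ⟨X₀, hX₀, ?_⟩ ?_
    · obtain ⟨R, hR0, hR⟩ := Metric.nhds_basis_closedBall.mem_iff.1 (hP.mem_nhds hX₀)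
      filter_upwards [Metric.ball_mem_nhds X₀ (half_pos hR0)] with Y hY
        using hball X₀ hX₀ h0 _ R (half_pos hR0) (half_lt_self hR0) hR Y hY
    · rintro X ⟨hXc, hXP⟩
      obtain ⟨R, hR0, hR⟩ := Metric.nhds_basis_closedBall.mem_iff.1 (hP.mem_nhds hXP)
      obtain ⟨Y, hY, hYX⟩ := Metric.mem_closure_iff.1 hXc (R / 4) (by linarith)
      have hs : Metric.closedBall Y (R / 2) ⊆ P := fun Z hZ => hR (by
        rw [Metric.mem_closedBall] at hZ ⊢
        linarith [dist_triangle Z Y X, dist_comm X Y])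
      have hYP : Y ∈ P := hs (Metric.mem_closedBall_self (by linarith))
      filter_upwards [Metric.isOpen_ball.mem_nhds (show X ∈ Metric.ball Y (R / 4) from hYX)]
        with Z hZ
      exact hball Y hYP hY.self_of_nhds (R / 4) (R / 2) (by linarith) (by linarith) hs Z hZ
  exact fun X hX => (hsub hX).self_of_nhds

lemma dist_reflectLast {X Z : EuclideanSpace ℝ (Fin (n + 1))} (hX : X (Fin.last n) = 0) :
    dist (reflectLast Z) X = dist Z X := by
  rw [EuclideanSpace.dist_eq, EuclideanSpace.dist_eq, Fin.sum_univ_castSucc,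
    Fin.sum_univ_castSucc]
  simp [reflectLast, hX, Fin.castSucc_ne_last]

lemma reflectLast_last (Z : EuclideanSpace ℝ (Fin (n + 1))) :
    reflectLast Z (Fin.last n) = -Z (Fin.last n) := by simp [reflectLast]

lemma volume_hyperplane :
    volume {X : EuclideanSpace ℝ (Fin (n + 1)) | X (Fin.last n) = 0} = 0 := by
  have h := Measure.addHaar_submodule (volume : Measure (EuclideanSpace ℝ (Fin (n + 1))))
    (LinearMap.ker (EuclideanSpace.proj (Fin.last n) :
      EuclideanSpace ℝ (Fin (n + 1)) →L[ℝ] ℝ).toLinearMap) (fun htop => by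
      have : (EuclideanSpace.single (Fin.last n) (1 : ℝ) : EuclideanSpace ℝ (Fin (n + 1))) ∈
        LinearMap.ker (EuclideanSpace.proj (Fin.last n) :
          EuclideanSpace ℝ (Fin (n + 1)) →L[ℝ] ℝ).toLinearMap := htop ▸ Submodule.mem_top
      simp at this)
  exact h

/-- A minimizer that vanishes at a point off the hyperplane vanishes identically. -/
theorem IsMinimizer.eq_zero_of_off_thin (h : IsMinimizer Ω w) (hΩ : IsOpen Ω)
    (hΩc : IsPreconnected Ω) {X₀ : EuclideanSpace ℝ (Fin (n + 1))} (hX₀ : X₀ ∈ Ω)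
    (hX₀' : X₀ (Fin.last n) ≠ 0) (h0 : w X₀ = 0) : ∀ X ∈ Ω, w X = 0 := by
  have hoff : ∀ X ∈ Ω, X (Fin.last n) ≠ 0 → ∃ R > 0, Metric.ball X R ⊆ Ω ∧
      ∀ Y ∈ Metric.ball X R, Y (Fin.last n) ≠ 0 := fun X hX hX' => by
    obtain ⟨R, hR0, hR⟩ := Metric.mem_nhds_iff.1 ((hΩ.inter isOpen_off_thin).mem_nhds ⟨hX, hX'⟩)
    exact ⟨R, hR0, fun Y hY => (hR hY).1, fun Y hY => (hR hY).2⟩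
  have hsub : Ω ⊆ {X | ∀ᶠ Y in 𝓝 X, w Y = 0} := by
    refine hΩc.subset_of_closure_inter_subset isOpen_setOfPred_eventually_nhds ⟨X₀, hX₀, ?_⟩ ?_
    · obtain ⟨R, hR0, hRΩ, hRt⟩ := hoff X₀ hX₀ hX₀'
      filter_upwards [Metric.ball_mem_nhds X₀ hR0] with Y hY
        using h.eq_zero_of_isPreconnected hΩ Metric.isOpen_ball (convex_ball _ _).isPreconnected
          hRΩ hRt (Metric.mem_ball_self hR0) h0 Y hY
    · rintro X ⟨hXc, hXΩ⟩
      by_cases hX : X (Fin.last n) = 0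
      · obtain ⟨R, hR0, hR⟩ := Metric.mem_nhds_iff.1 (hΩ.mem_nhds hXΩ)
        obtain ⟨Y, hY, hYX⟩ := Metric.mem_closure_iff.1 hXc R hR0
        -- Since `w` vanishes near `Y`, a small vertical shift gives a zero off the hyperplane, from
        -- which vanishing spreads through an open half ball.
        obtain ⟨Y', hY'0, hY'R, hY't⟩ : ∃ Y', w Y' = 0 ∧ Y' ∈ Metric.ball X R ∧
            Y' (Fin.last n) ≠ 0 := by
          by_cases hYt : Y (Fin.last n) = 0
          · have hc : Tendsto (fun t : ℝ => Y + t • EuclideanSpace.single (Fin.last n) (1 : ℝ))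
                (𝓝[>] 0) (𝓝 Y) := by
              have : Continuous fun t : ℝ =>
                Y + t • EuclideanSpace.single (Fin.last n) (1 : ℝ) := by fun_prop
              simpa using (this.tendsto 0).mono_left nhdsWithin_le_nhds
            have hb : Metric.ball X R ∈ 𝓝 Y :=
              Metric.isOpen_ball.mem_nhds (by rwa [Metric.mem_ball, dist_comm])
            obtain ⟨t, ⟨ht1, ht2⟩, ht3⟩ := (((hc.eventually hY).and (hc.eventually hb)).and
              self_mem_nhdsWithin).exists
            refine ⟨_, ht1, ht2, ?_⟩
            simpa [hYt] using (ne_of_gt ht3)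
          · exact ⟨Y, hY.self_of_nhds, by rwa [Metric.mem_ball, dist_comm], hYt⟩
        have hlin : IsLinearMap ℝ fun Z : EuclideanSpace ℝ (Fin (n + 1)) => Z (Fin.last n) :=
          ⟨fun _ _ => rfl, fun _ _ => rfl⟩
        have hc : Continuous fun Z : EuclideanSpace ℝ (Fin (n + 1)) => Z (Fin.last n) := by fun_prop
        have hup : ∀ Y'', w Y'' = 0 → Y'' ∈ Metric.ball X R → 0 < Y'' (Fin.last n) →
            ∀ Z ∈ Metric.ball X R, 0 < Z (Fin.last n) → w Z = 0 := fun Y'' h1 h2 h3 Z hZ hZ0 =>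
          h.eq_zero_of_isPreconnected hΩ
            (P := Metric.ball X R ∩ {Z | 0 < Z (Fin.last n)})
            (Metric.isOpen_ball.inter (isOpen_lt continuous_const hc))
            ((convex_ball X R).inter (convex_halfSpace_gt hlin 0)).isPreconnected
            (Set.inter_subset_left.trans hR) (fun Z hZ => hZ.2.ne') ⟨h2, h3⟩ h1 Z ⟨hZ, hZ0⟩
        have href : ∀ Z ∈ Metric.ball X R, reflectLast Z ∈ Metric.ball X R := fun Z hZ => by
          rwa [Metric.mem_ball, dist_reflectLast hX]
        -- The center lies on the hyperplane, so the ball is symmetric and evenness lets the zero be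
        -- taken in the upper half.
        have hpos : ∀ Z ∈ Metric.ball X R, 0 < Z (Fin.last n) → w Z = 0 := by
          rcases lt_or_gt_of_ne hY't with hneg | hpos
          · refine hup (reflectLast Y') (by rw [h.even _ (hR hY'R), hY'0]) (href _ hY'R) ?_
            rw [reflectLast_last]; linarith
          · exact hup Y' hY'0 hY'R hpos
        have hall : ∀ Z ∈ Metric.ball X R, Z (Fin.last n) ≠ 0 → w Z = 0 := by
          intro Z hZ hZ0
          rcases lt_or_gt_of_ne hZ0 with hneg | hpos'
          · rw [← h.even Z (hR hZ)]
            exact hpos _ (href Z hZ) (by rw [reflectLast_last]; linarith)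
          · exact hpos Z hZ hpos'
        -- Vanishing on both half balls is vanishing almost everywhere, since the hyperplane is
        -- null; precise values then fill it in.
        have hae : ∀ᵐ Z ∂volume, Z ∈ Metric.ball X R → w Z = 0 := by
          have : ∀ᵐ Z : EuclideanSpace ℝ (Fin (n + 1)) ∂volume, Z (Fin.last n) ≠ 0 := by
            rw [ae_iff]; simpa using volume_hyperplane
          filter_upwards [this] with Z hZ hZb using hall Z hZb hZ
        filter_upwards [Metric.ball_mem_nhds X hR0] with Z hZ
          using h.eq_zero_of_ae Metric.isOpen_ball hR hae Z hZ
      · obtain ⟨R, hR0, hRΩ, hRt⟩ := hoff X hXΩ hX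
        obtain ⟨Y, hY, hYX⟩ := Metric.mem_closure_iff.1 hXc R hR0
        filter_upwards [Metric.ball_mem_nhds X hR0] with Z hZ
          using h.eq_zero_of_isPreconnected hΩ Metric.isOpen_ball (convex_ball _ _).isPreconnected
            hRΩ hRt (by rwa [Metric.mem_ball, dist_comm]) hY.self_of_nhds Z hZ
  exact fun X hX => (hsub hX).self_of_nhds

end Propagation

/-! ### Hausdorff convergence of the zero sets -/

section HausdorffConvergence

variable {u : ℕ → EuclideanSpace ℝ (Fin (n + 1)) → ℝ} {uLim : EuclideanSpace ℝ (Fin (n + 1)) → ℝ}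
  {G : ℕ → EuclideanSpace ℝ (Fin (n + 1)) → EuclideanSpace ℝ (Fin (n + 1))}
  {g : EuclideanSpace ℝ (Fin (n + 1)) → EuclideanSpace ℝ (Fin (n + 1))}

/-- Cutting a minimizer off near a hyperplane ball where it is positive costs at least the measure
of this ball. -/
lemma IsMinimizer.measure_ball_le (h : IsMinimizer Ω w) (hΩ : IsOpen Ω)
    {x : EuclideanSpace ℝ (Fin n)} {r R : ℝ} (hr : 0 < r) (hrR : r < R)
    (hR : Metric.closedBall (thin x) R ⊆ Ω) {G} (hG : IsH1 Ω w G)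
    (hpos : ∀ y ∈ Metric.ball x r, 0 < w (thin y)) {φ : EuclideanSpace ℝ (Fin (n + 1)) → ℝ}
    (hφ : ContDiff ℝ ∞ φ) {K} (hK : IsCompact K) (hKR : K ⊆ Metric.ball (thin x) R)
    (hφK : tsupport φ ⊆ K) (hφ0 : ∀ X, 0 ≤ φ X)
    (hφr : ∀ X ∈ Metric.closedBall (thin x) r, φ X = 1) :
    volume.real (Metric.ball x r) ≤
      ∫ X in Metric.ball (thin x) R, ‖G X - (φ X • G X + w X • gradient φ X)‖ ^ 2 := by
  have hD := isSubdomain_ball (hr.trans hrR) hR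
  have hv := hG.sub hΩ (hG.smooth_mul hΩ hφ)
  have h1 := h.minimizes.energy_le hD hG hv hK hKR (fun X _ hX => by
    simp [image_eq_zero_of_notMem_tsupport (fun h => hX (hφK h))])
  have hb : ∀ y ∈ Metric.ball x r, thin y ∈ Metric.ball (thin x) r := fun y hy => by
    rwa [Metric.mem_ball, isometry_thin.dist_eq]
  -- The competitor $(1-\varphi)w$ lies below $w$ and vanishes identically near the small hyperplane
  -- ball, so its positivity set loses that whole ball.
  have h2 : thinPositive (fun X => w X - φ X * w X) (Metric.ball (thin x) R) ⊆
      thinPositive w (Metric.ball (thin x) R) \ Metric.ball x r := by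
    intro y hy
    refine ⟨thinPositive_subset_of_le hΩ hD.self_subset h hG hv (fun X hX => ?_) hy, fun hyb => ?_⟩
    · have := mul_nonneg (hφ0 X) (h.nonneg X hX)
      linarith
    · obtain ⟨-, a, ha, hay⟩ := hy
      have h3 := (hasPreciseValue_congr (u := fun _ => 0) Metric.isOpen_ball (hb y hyb)
        (Eventually.of_forall fun Y hY => by
          simp [hφr Y (Metric.ball_subset_closedBall hY)])).1 hay
      refine ha.ne' (tendsto_nhds_unique h3 ?_)
      simp only [average_zero]
      exact tendsto_const_nhds
  have h3 : Metric.ball x r ⊆ thinPositive w (Metric.ball (thin x) R) := fun y hy => by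
    have hy' := Metric.ball_subset_ball hrR.le (hb y hy)
    exact ⟨hy', _, hpos y hy, h.precise _ (hD.self_subset hy')⟩
  have hfin := volume_thinPositive_ne_top (u := w) hD.isBounded
  have h4 := measureReal_mono h2 (ne_top_of_le_ne_top hfin (measure_mono Set.sdiff_subset))
  have h5 := measureReal_inter_add_sdiff (μ := volume)
    (s := thinPositive w (Metric.ball (thin x) R)) (t := Metric.ball x r)
    Metric.isOpen_ball.measurableSet hfin
  rw [Set.inter_eq_right.2 h3] at h5
  have h6 : 0 ≤ ∫ X in Metric.ball (thin x) R, ‖G X‖ ^ 2 := by positivity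
  linarith

/-- If minimizers converge to zero near a point of the hyperplane, they have zeros on the
hyperplane nearby. -/
lemma eventually_exists_zero (hΩ : IsOpen Ω) (hu : ∀ k, IsMinimizer Ω (u k))
    (hG : ∀ k, IsH1 Ω (u k) (G k)) (hg : IsH1 Ω uLim g) (hlim : IsMinimizer Ω uLim)
    (hconv : TendstoLocallyUniformlyOn u uLim atTop Ω)
    (hGg : ∀ K : Set (EuclideanSpace ℝ (Fin (n + 1))), IsCompact K → K ⊆ Ω →
      Tendsto (fun k => eLpNorm (G k - g) 2 (volume.restrict K)) atTop (𝓝 0))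
    {x y : EuclideanSpace ℝ (Fin n)} {R : ℝ} (hR0 : 0 < R)
    (hR : Metric.closedBall (thin x) R ⊆ Ω) (hy : y ∈ Metric.ball x (R / 4))
    (hy0 : uLim (thin y) = 0) :
    ∀ᶠ k in atTop, ∃ z ∈ Metric.ball x R, u k (thin z) = 0 := by
  by_contra hcon
  -- Otherwise infinitely many `u k` are positive on the hyperplane ball, hence harmonic in the full
  -- ball.
  have hfreq : ∃ᶠ k in atTop, ∀ z ∈ Metric.ball x R, 0 < u k (thin z) := by
    refine (not_eventually.1 hcon).mono fun k hk z hz => ?_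
    have hz' : thin z ∈ Ω := hR (Metric.ball_subset_closedBall
      (by rwa [Metric.mem_ball, isometry_thin.dist_eq]))
    exact lt_of_le_of_ne ((hu k).nonneg _ hz') fun h => hk ⟨z, hz, h.symm⟩
  have hthin : ∀ (z : EuclideanSpace ℝ (Fin n)) (r : ℝ),
      thin z ∈ Metric.ball (thin x) r ↔ z ∈ Metric.ball x r := fun z r => by
    rw [Metric.mem_ball, Metric.mem_ball, isometry_thin.dist_eq]
  have hR4 : Metric.closedBall (thin x) (R / 4) ⊆ Ω :=
    (Metric.closedBall_subset_closedBall (by linarith)).trans hR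
  have hyΩ : thin y ∈ Ω := hR4 (Metric.ball_subset_closedBall ((hthin y _).2 hy))
  have hD := isSubdomain_ball (show 0 < R / 4 by linarith) hR4
  have hle : volume.restrict (Metric.ball (thin x) (R / 4)) ≤
      volume.restrict (Metric.closedBall (thin x) (R / 4)) :=
    Measure.restrict_mono Metric.ball_subset_closedBall le_rfl
  have hmU := memLp_limit hG hΩ hconv (isCompact_closedBall _ _) hR4
  have tU : Tendsto (fun k => eLpNorm (u k - uLim) 2
      (volume.restrict (Metric.ball (thin x) (R / 4)))) atTop (𝓝 0) :=
    tendsto_of_tendsto_of_tendsto_of_le_of_le tendsto_const_nhds hmU.2 (fun _ => bot_le)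
      fun k => eLpNorm_mono_measure _ hle
  have tG : Tendsto (fun k => eLpNorm (G k - g) 2
      (volume.restrict (Metric.ball (thin x) (R / 4)))) atTop (𝓝 0) :=
    tendsto_of_tendsto_of_tendsto_of_le_of_le tendsto_const_nhds
      (hGg _ (isCompact_closedBall _ _) hR4) (fun _ => bot_le)
      fun k => eLpNorm_mono_measure _ hle
  have hfin : IsFiniteMeasure (volume.restrict (Metric.ball (thin x) (R / 4))) :=
    ⟨by simpa using measure_ball_lt_top⟩
  -- Harnack gives $\int_{B_{R/4}}u_k\le C\,u_k(y,0)$ for infinitely many `k`, and the right side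
  -- tends to $C\,u(y,0)=0$.
  have hzero : ∀ Y ∈ Metric.ball (thin x) (R / 4), uLim Y = 0 := by
    refine hlim.eq_zero_of_setIntegral_le hR4 ?_
    have t1 := tendsto_integral_of_tendsto_eLpNorm_two (fun k => ((hG k).memLp hD).1)
      (hg.memLp hD).1 tU
    have t2 := (hconv.tendsto_at hyΩ).const_mul
      (volume.real (Metric.ball (0 : EuclideanSpace ℝ (Fin (n + 1))) (R / 2)))
    rw [hy0, mul_zero] at t2
    refine le_of_tendsto_of_tendsto_of_frequently t1 t2 (hfreq.mono fun k hk => ?_)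
    exact (hu k).setIntegral_le hΩ hR0 hR (fun z hz => hk z ((hthin z R).1 hz))
      ((hthin y _).2 hy)
  have hgzero : ∀ᵐ X ∂volume, X ∈ Metric.ball (thin x) (R / 4) → g X = 0 :=
    (hg.1.mono hD.self_subset).ae_eq Metric.isOpen_ball (isH1_const Metric.isOpen_ball 0).1
      (Eventually.of_forall hzero)
  obtain ⟨φ, K, M, hφ, hK, hKb, hsupp, hφ0, hφ1, hφr, hM0, hM⟩ :=
    exists_ball_cutoff (thin x) (show 0 < R / 8 by linarith) (show R / 8 < R / 4 by linarith)
  have hF := fun k => (((hG k).sub hΩ ((hG k).smooth_mul hΩ hφ)).memLp hD).2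
  have tF : Tendsto (fun k => ∫ X in Metric.ball (thin x) (R / 4),
      ‖G k X - (φ X • G k X + u k X • gradient φ X)‖ ^ 2) atTop (𝓝 0) := by
    have t1 : Tendsto (fun k => eLpNorm (fun X => (1 - φ X) • (G k - g) X) 2
        (volume.restrict (Metric.ball (thin x) (R / 4)))) atTop (𝓝 0) := by
      refine tendsto_eLpNorm_of_norm_le 1 tG fun k => Eventually.of_forall fun X => ?_
      rw [norm_smul]
      gcongr
      rw [Real.norm_eq_abs, abs_le]
      constructor <;> linarith [hφ0 X, hφ1 X]
    have t2 : Tendsto (fun k => eLpNorm (fun X => (u k - uLim) X • gradient φ X) 2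
        (volume.restrict (Metric.ball (thin x) (R / 4)))) atTop (𝓝 0) := by
      refine tendsto_eLpNorm_of_norm_le M tU fun k => Eventually.of_forall fun X => ?_
      rw [norm_smul, mul_comm]
      gcongr
      exact hM X
    have hmeas1 : ∀ k, AEStronglyMeasurable (fun X => (1 - φ X) • (G k - g) X)
        (volume.restrict (Metric.ball (thin x) (R / 4))) := fun k =>
      (continuous_const.sub hφ.continuous).aestronglyMeasurable.smul
        (((hG k).memLp hD).2.sub (hg.memLp hD).2).1
    have hmeas2 : ∀ k, AEStronglyMeasurable (fun X => (u k - uLim) X • gradient φ X)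
        (volume.restrict (Metric.ball (thin x) (R / 4))) := fun k =>
      (((hG k).memLp hD).1.sub (hg.memLp hD).1).1.smul (continuous_gradient hφ).aestronglyMeasurable
    have t3 : Tendsto (fun k => eLpNorm ((fun X => G k X - (φ X • G k X + u k X • gradient φ X)) -
        fun _ => 0) 2 (volume.restrict (Metric.ball (thin x) (R / 4)))) atTop (𝓝 0) := by
      refine tendsto_of_tendsto_of_tendsto_of_le_of_le tendsto_const_nhds
        (by simpa using t1.add t2) (fun _ => bot_le) fun k => ?_
      -- As `uLim` and `g` vanish on this ball, the gradient of the cut-off competitor is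
      -- $(1-\varphi)(G_k-g)-(u_k-u)\nabla\varphi$, and both pieces tend to zero.
      refine le_trans (le_of_eq (eLpNorm_congr_ae ?_))
        (eLpNorm_sub_le (hmeas1 k) (hmeas2 k) (by norm_num))
      filter_upwards [ae_restrict_of_ae hgzero, ae_restrict_mem Metric.isOpen_ball.measurableSet]
        with X h1 h2
      simp only [Pi.sub_apply, h1 h2, hzero X h2, sub_zero]
      module
    simpa using tendsto_integral_norm_sq hF (MemLp.zero' (p := 2)) t3
  have hpos := volume_real_ball_pos x (show 0 < R / 8 by linarith)
  -- For such a `k` the Dirichlet cost of the cutoff is less than the area of $B_{R/8}$ that it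
  -- saves.
  obtain ⟨k, hk1, hk2⟩ := (hfreq.and_eventually (tF.eventually (gt_mem_nhds hpos))).exists
  have h1 := (hu k).measure_ball_le hΩ (show 0 < R / 8 by linarith)
    (show R / 8 < R / 4 by linarith) hR4 (hG k)
    (fun z hz => hk1 z (Metric.ball_subset_ball (by linarith) hz)) hφ hK hKb hsupp hφ0 hφr
  linarith

/-- Convergence of the zero sets on the hyperplane. -/
theorem thinZero_tendsto (hΩ : IsOpen Ω) (hu : ∀ k, IsMinimizer Ω (u k))
    (hG : ∀ k, IsH1 Ω (u k) (G k)) (hg : IsH1 Ω uLim g) (hlim : IsMinimizer Ω uLim)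
    (hconv : TendstoLocallyUniformlyOn u uLim atTop Ω)
    (hGg : ∀ K : Set (EuclideanSpace ℝ (Fin (n + 1))), IsCompact K → K ⊆ Ω →
      Tendsto (fun k => eLpNorm (G k - g) 2 (volume.restrict K)) atTop (𝓝 0)) :
    LocallyHausdorffTendsto {x | thin x ∈ Ω} (fun k => thinZero Ω (u k)) (thinZero Ω uLim) := by
  intro K hK hKΩ ε hε
  -- Compactness reduces both inclusions to a small ball around each point of `K`.
  refine hK.induction_on (p := fun S => ∀ᶠ k in atTop,
    thinZero Ω (u k) ∩ S ⊆ Metric.thickening ε (thinZero Ω uLim) ∧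
      thinZero Ω uLim ∩ S ⊆ Metric.thickening ε (thinZero Ω (u k))) ?_ ?_ ?_ ?_
  · simp
  · intro s t hst ht
    filter_upwards [ht] with k hk
    exact ⟨(Set.inter_subset_inter_right _ hst).trans hk.1,
      (Set.inter_subset_inter_right _ hst).trans hk.2⟩
  · intro s t hs ht
    filter_upwards [hs, ht] with k hk1 hk2
    rw [Set.inter_union_distrib_left, Set.inter_union_distrib_left]
    exact ⟨Set.union_subset hk1.1 hk2.1, Set.union_subset hk1.2 hk2.2⟩
  · intro x hx
    obtain ⟨R', hR'0, hR'⟩ := Metric.nhds_basis_closedBall.mem_iff.1 (hΩ.mem_nhds (hKΩ hx))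
    -- With $R\le\varepsilon/2$, a point of $B_{R/4}(x)$ and one of $B_R(x)$ are less than
    -- $\varepsilon$ apart, so any zero in $B_R(x)$ is close enough.
    set R := min R' (ε / 2) with hRdef
    have hR0 : 0 < R := lt_min hR'0 (half_pos hε)
    have hRε : R ≤ ε / 2 := min_le_right _ _
    have hR : Metric.closedBall (thin x) R ⊆ Ω :=
      (Metric.closedBall_subset_closedBall (min_le_left _ _)).trans hR'
    have hthin : ∀ (z : EuclideanSpace ℝ (Fin n)) (r : ℝ),
        thin z ∈ Metric.ball (thin x) r ↔ z ∈ Metric.ball x r := fun z r => by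
      rw [Metric.mem_ball, Metric.mem_ball, isometry_thin.dist_eq]
    have hballΩ : ∀ z ∈ Metric.ball x R, thin z ∈ Ω := fun z hz =>
      hR (Metric.ball_subset_closedBall ((hthin z R).2 hz))
    have hdist : ∀ y ∈ Metric.ball x (R / 4), ∀ z ∈ Metric.ball x R, dist y z < ε := by
      intro y hy z hz
      rw [Metric.mem_ball] at hy hz
      linarith [dist_triangle y x z, dist_comm x z]
    refine ⟨Metric.ball x (R / 4), mem_nhdsWithin_of_mem_nhds
      (Metric.ball_mem_nhds x (by linarith)), ?_⟩
    refine Eventually.and ?_ ?_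
    · by_cases hz : ∃ z ∈ Metric.ball x R, uLim (thin z) = 0
      · obtain ⟨z, hz, hz0⟩ := hz
        refine Eventually.of_forall fun k y hy => ?_
        exact Metric.mem_thickening_iff.2 ⟨z, ⟨hballΩ z hz, hz0⟩, hdist y hy.2 z hz⟩
      -- If the limit has no zero in $B_R(x)$, its positive lower bound on the smaller ball excludes
      -- zeros of `u k` there for large `k`.
      · have hpos : ∀ z ∈ Metric.ball x R, 0 < uLim (thin z) := fun z hzb =>
          lt_of_le_of_ne (hlim.nonneg _ (hballΩ z hzb)) fun h => hz ⟨z, hzb, h.symm⟩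
        obtain ⟨c, hc0, hc⟩ := hlim.exists_pos_lower_bound hΩ hR0 hR
          (fun z hz => hpos z ((hthin z R).1 hz)) (hpos x (Metric.mem_ball_self hR0))
        have hunif := (tendstoLocallyUniformlyOn_iff_forall_isCompact hΩ).1 hconv _ hR
          (isCompact_closedBall _ _)
        filter_upwards [Metric.tendstoUniformlyOn_iff.1 hunif c hc0] with k hk y hy
        have hyb := (hthin y _).2 hy.2
        have h1 := hk _ (Metric.ball_subset_closedBall
          (Metric.ball_subset_ball (by linarith) hyb))
        have h2 := hc _ hyb
        rw [hy.1.2, Real.dist_eq, sub_zero, abs_lt] at h1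
        linarith [h1.2]
    · by_cases hy : ∃ y ∈ Metric.ball x (R / 4), uLim (thin y) = 0
      · obtain ⟨y, hy, hy0⟩ := hy
        filter_upwards [eventually_exists_zero hΩ hu hG hg hlim hconv hGg hR0 hR hy hy0]
          with k ⟨z, hz, hz0⟩ y' hy'
        exact Metric.mem_thickening_iff.2 ⟨z, ⟨hballΩ z hz, hz0⟩, hdist y' hy'.2 z hz⟩
      · exact Eventually.of_forall fun k y' hy' => absurd ⟨y', hy'.2, hy'.1.2⟩ hy

/-- Convergence of the full zero sets, given convergence on the hyperplane. -/
theorem zero_tendsto (hΩ : IsOpen Ω) (hΩc : IsPreconnected Ω) (hu : ∀ k, IsMinimizer Ω (u k))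
    (hlim : IsMinimizer Ω uLim) (hconv : TendstoLocallyUniformlyOn u uLim atTop Ω)
    (hthin : LocallyHausdorffTendsto {x | thin x ∈ Ω} (fun k => thinZero Ω (u k))
      (thinZero Ω uLim)) (hne : ∃ X ∈ Ω, uLim X ≠ 0) :
    LocallyHausdorffTendsto Ω (fun k => {X | X ∈ Ω ∧ u k X = 0}) {X | X ∈ Ω ∧ uLim X = 0} := by
  obtain ⟨X₀, hX₀, hX₀ne⟩ := hne
  -- A minimizer that is nonzero at `X₀` has all its zeros on the hyperplane. This applies to the
  -- limit and, by pointwise convergence at `X₀`, to `u k` for large `k`.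
  have hz : ∀ w : EuclideanSpace ℝ (Fin (n + 1)) → ℝ, IsMinimizer Ω w → w X₀ ≠ 0 →
      ∀ X ∈ Ω, w X = 0 → ∃ x, thin x = X := fun w hw hw0 X hX hX0 =>
    thin_surj (by_contra fun h => hw0 (hw.eq_zero_of_off_thin hΩ hΩc hX h hX0 X₀ hX₀))
  have key : ∀ (v w : EuclideanSpace ℝ (Fin (n + 1)) → ℝ) (K : Set _) (ε : ℝ),
      IsMinimizer Ω v → v X₀ ≠ 0 →
      thinZero Ω v ∩ thin ⁻¹' K ⊆ Metric.thickening ε (thinZero Ω w) →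
      {X | X ∈ Ω ∧ v X = 0} ∩ K ⊆ Metric.thickening ε {X | X ∈ Ω ∧ w X = 0} := by
    rintro v w K ε hv hv0 hsub X ⟨⟨hXΩ, hX0⟩, hXK⟩
    obtain ⟨x, rfl⟩ := hz v hv hv0 X hXΩ hX0
    obtain ⟨y, hy, hxy⟩ := Metric.mem_thickening_iff.1 (hsub ⟨⟨hXΩ, hX0⟩, hXK⟩)
    exact Metric.mem_thickening_iff.2 ⟨thin y, hy, by rwa [isometry_thin.dist_eq]⟩
  intro K hK hKΩ ε hε
  have hK' : IsCompact (thin ⁻¹' K) := isometry_thin.isClosedEmbedding.isCompact_preimage hK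
  filter_upwards [hthin _ hK' (fun x hx => hKΩ hx) ε hε,
    (hconv.tendsto_at hX₀).eventually_ne hX₀ne] with k hk hk0
  exact ⟨key _ _ K ε (hu k) hk0 hk.1, key _ _ K ε hlim hX₀ne hk.2⟩

end HausdorffConvergence

end ZeroSets

end ThinOnePhase

end

theorem mainTheorem10 (n : ℕ) (hn : 1 ≤ n)
    (Ω : Set (EuclideanSpace ℝ (Fin (n + 1))))
    (hΩopen : IsOpen Ω) (hΩconn : IsConnected Ω)
    (hΩsymm : ∀ X ∈ Ω, ThinOnePhase.reflectLast X ∈ Ω)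
    (u : ℕ → EuclideanSpace ℝ (Fin (n + 1)) → ℝ)
    (uLim : EuclideanSpace ℝ (Fin (n + 1)) → ℝ)
    (hu : ∀ k, ThinOnePhase.IsMinimizer Ω (u k))
    (hconv : TendstoLocallyUniformlyOn u uLim atTop Ω) :
    ThinOnePhase.IsMinimizer Ω uLim ∧
      ThinOnePhase.LocallyHausdorffTendsto {x | ThinOnePhase.thin x ∈ Ω}
        (fun k => ThinOnePhase.thinZero Ω (u k)) (ThinOnePhase.thinZero Ω uLim) ∧
      ((∃ X ∈ Ω, uLim X ≠ 0) →
        ThinOnePhase.LocallyHausdorffTendsto Ω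
          (fun k => {X | X ∈ Ω ∧ u k X = 0}) {X | X ∈ Ω ∧ uLim X = 0}) := by
  choose G hG using fun k => (hu k).exists_isH1
  obtain ⟨g, hg, hGg⟩ := ThinOnePhase.exists_gradient_limit hΩopen hu hG hconv
  have hlim := ThinOnePhase.isMinimizer_of_tendsto hΩopen hΩsymm hu hG hg hconv hGg
  have hthin := ThinOnePhase.thinZero_tendsto hΩopen hu hG hg hlim hconv hGg
  exact ⟨hlim, hthin, ThinOnePhase.zero_tendsto hΩopen hΩconn.isPreconnected hu hlim hconv hthin⟩
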